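/- For an integer $n\ge 0$ let $Y_n=Y(\mathfrak{gl}_n)$ be the Yangian over $\mathbb C$: the unital associative $\mathbb C$-algebra generated by elements $T_{i,j}^{(r)}$ ($1\le i,j\le n$, $r\ge 1$) subject to the relations $$(u-v)\,[T_{i,j}(u),T_{h,k}(v)]=T_{h,j}(u)\,T_{i,k}(v)-T_{h,j}(v)\,T_{i,k}(u)\qquad(1\le i,j,h,k\le n),$$ where $T_{i,j}(u)=\sum_{r\ge 0}T_{i,j}^{(r)}u^{-r}\in Y_n[[u^{-1}]]$ and $T_{i,j}^{(0)}=\delta_{i,j}$. Write $T(u)=(T_{i,j}(u))_{1\le i,j\le n}$, and let $\omega_n:Y_n\to Y_n$ be the algebra homomorphism defined by $\omega_n(T(u))=T(-u)^{-1}$ (applied entrywise and coefficientwise). Let $m,n\ge 0$. Let $\iota:Y_m\to Y_{m+n}$ be the standard embedding $T_{i,j}^{(r)}\mapsto T_{i,j}^{(r)}$, let $\varphi_m:Y_n\to Y_{m+n}$ be the homomorphism $T_{i,j}^{(r)}\mapsto T_{m+i,m+j}^{(r)}$, and let $\psi_m=\omega_{m+n}\circ\varphi_m\circ\omega_n:Y_n\to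 Y_{m+n}$. **Theorem 7.3.** The centralizer of $\iota(Y_m)$ in $Y_{m+n}$ is equal to $\iota(Z(Y_m))\,\psi_m(Y_n)$, where $Z(Y_m)$ is the center of $Y_m$ and the product of two subspaces is the linear span of the products of their elements. -/

import Mathlib

noncomputable section

/-- Inverting the relation `(x - y) [F, G] = x y (P F G - G F P)`, with `x`, `y` central. -/
theorem rtt_inverse_aux {B : Type*} [Ring B] (x y P F G F' G' : B)
    (hx : ∀ z, x * z = z * x) (hy : ∀ z, y * z = z * y)
    (eF : F * F' = 1) (eF' : F' * F = 1) (eG : G * G' = 1) (eG' : G' * G = 1)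
    (h : y * (F * G - G * F) - x * (F * G - G * F) = x * (y * (P * (F * G) - G * F * P))) :
    y * (F' * G' - G' * F') - x * (F' * G' - G' * F')
      = x * (y * (F' * G' * P - P * (G' * F'))) := by
  have h4 : F' * G' * (G * F) = 1 := by
    rw [mul_assoc, ← mul_assoc G', eG', one_mul, eF']
  have h5 : F * G * (G' * F') = 1 := by
    rw [mul_assoc, ← mul_assoc G, eG, one_mul, eF]
  have h6 : F' * G' * (F * G - G * F) * (G' * F') = F' * G' - G' * F' := by
    rw [mul_sub, sub_mul, h4, one_mul, mul_assoc _ (F * G), h5, mul_one]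
  have h7 : F' * G' * (P * (F * G) - G * F * P) * (G' * F') = F' * G' * P - P * (G' * F') := by
    rw [mul_sub, sub_mul, ← mul_assoc _ (G * F), h4, one_mul, ← mul_assoc _ P,
      mul_assoc _ (F * G), h5, mul_one]
  have pull : ∀ c : B, (∀ z, c * z = z * c) → ∀ w,
      F' * G' * (c * w) * (G' * F') = c * (F' * G' * w * (G' * F')) := by
    intro c hc w
    rw [← mul_assoc (F' * G') c w, ← hc (F' * G')]
    simp only [mul_assoc]
  have h8 := congrArg (fun z => F' * G' * z * (G' * F')) h
  rw [mul_sub (F' * G') (y * _), sub_mul (F' * G' * (y * _)), pull y hy, pull x hx, pull x hx,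
    pull y hy, h6, h7] at h8
  exact h8

open PowerSeries in
/-- If `f = ∑ f_r x^r` and `g = ∑ g_s y^s` satisfy the coefficient form of the equation
`(x⁻¹ - y⁻¹ - p) f(x) g(y) = g(y) f(x) (x⁻¹ - y⁻¹ - p)`, then their inverses satisfy the
coefficient form of the inverted equation. -/
theorem rtt_inverse {A : Type*} [Ring A] (p : A) (f g f' g' : PowerSeries A)
    (hf0 : coeff 0 f = 1) (hg0 : coeff 0 g = 1)
    (hff : f * f' = 1) (hff' : f' * f = 1) (hgg : g * g' = 1) (hgg' : g' * g = 1)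
    (H : ∀ r s : ℕ,
      (coeff (r + 1) f * coeff s g - coeff s g * coeff (r + 1) f)
        - (coeff r f * coeff (s + 1) g - coeff (s + 1) g * coeff r f)
      = p * coeff r f * coeff s g - coeff s g * coeff r f * p) (r s : ℕ) :
    (coeff (r + 1) f' * coeff s g' - coeff s g' * coeff (r + 1) f')
        - (coeff r f' * coeff (s + 1) g' - coeff (s + 1) g' * coeff r f')
      = coeff r f' * coeff s g' * p - p * coeff s g' * coeff r f' := by
  have key := rtt_inverse_aux (B := PowerSeries (PowerSeries A)) (C X) X (C (C p)) (C f)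
    (PowerSeries.map (C (R := A)) g) (C f') (PowerSeries.map (C (R := A)) g')
    (fun z => by
      ext1 n
      simp only [coeff_C_mul, coeff_mul_C]
      exact X_mul)
    (fun z => X_mul)
    (by rw [← map_mul, hff, map_one]) (by rw [← map_mul, hff', map_one])
    (by rw [← map_mul, hgg, map_one]) (by rw [← map_mul, hgg', map_one])
    (by
      ext n m
      rcases n with _ | n
      · rcases m with _ | m
        · simp [coeff_C_mul]
        · simp only [map_sub, coeff_C_mul, coeff_zero_X_mul, mul_sub, coeff_succ_X_mul,
            coeff_mul_C, coeff_map, map_zero]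
          simp [hg0]
      · rcases m with _ | m
        · simp only [map_sub, coeff_C_mul, coeff_zero_X_mul, mul_sub, coeff_succ_X_mul,
            coeff_mul_C, coeff_map]
          simp [hf0]
        · have h := H m n
          simp only [map_sub, coeff_C_mul, mul_sub, coeff_succ_X_mul, coeff_mul_C, coeff_map]
          simpa only [mul_assoc] using h)
  have h9 := congrArg (fun z => coeff (r + 1) (coeff (s + 1) z)) key
  simp only [map_sub, coeff_C_mul, mul_sub, coeff_succ_X_mul, coeff_mul_C, coeff_map] at h9
  simpa only [mul_assoc] using h9

namespace Yangian

/-- The element `T_{i,j}^{(r)}` of the free algebra on the symbols `T_{i,j}^{(r)}`, `r ≥ 1`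
(the symbol `T_{i,j}^{(r+1)}` is the generator `(i, j, r)`), with `T_{i,j}^{(0)} = δ_{i,j}`. -/
def freeT (n : ℕ) (i j : Fin n) : ℕ → FreeAlgebra ℂ (Fin n × Fin n × ℕ)
  | 0 => if i = j then 1 else 0
  | r + 1 => FreeAlgebra.ι ℂ (i, j, r)

/-- The defining (RTT) relations of the Yangian: the `u^{-r} v^{-s}`-coefficients of
`(u - v) [T_{i,j}(u), T_{h,k}(v)] = T_{h,j}(u) T_{i,k}(v) - T_{h,j}(v) T_{i,k}(u)`.
(The coefficients at `u^1 v^{-s}` and `u^{-r} v^1` hold trivially as `T_{i,j}^{(0)}` is a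
scalar.) -/
inductive Rel (n : ℕ) :
    FreeAlgebra ℂ (Fin n × Fin n × ℕ) → FreeAlgebra ℂ (Fin n × Fin n × ℕ) → Prop
  | rtt (i j h k : Fin n) (r s : ℕ) : Rel n
      ((freeT n i j (r + 1) * freeT n h k s - freeT n h k s * freeT n i j (r + 1))
        - (freeT n i j r * freeT n h k (s + 1) - freeT n h k (s + 1) * freeT n i j r))
      (freeT n h j r * freeT n i k s - freeT n h j s * freeT n i k r)

end Yangian

/-- The Yangian `Y_n = Y(𝔤𝔩_n)` over `ℂ`, by its RTT presentation. -/
def Yangian (n : ℕ) : Type := RingQuot (Yangian.Rel n)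

namespace Yangian

instance (n : ℕ) : Ring (Yangian n) := inferInstanceAs (Ring (RingQuot (Rel n)))

instance (n : ℕ) : Algebra ℂ (Yangian n) := inferInstanceAs (Algebra ℂ (RingQuot (Rel n)))

/-- The quotient map from the free algebra. -/
def mk (n : ℕ) : FreeAlgebra ℂ (Fin n × Fin n × ℕ) →ₐ[ℂ] Yangian n :=
  RingQuot.mkAlgHom ℂ (Rel n)

/-- The element `T_{i,j}^{(r)}` of `Y_n`, for `r ≥ 0`. -/
def T (n : ℕ) (i j : Fin n) (r : ℕ) : Yangian n := mk n (freeT n i j r)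

theorem T_zero (n : ℕ) (i j : Fin n) : T n i j 0 = if i = j then 1 else 0 := by
  unfold T freeT
  split_ifs <;> simp

theorem T_rel (n : ℕ) (i j h k : Fin n) (r s : ℕ) :
    (T n i j (r + 1) * T n h k s - T n h k s * T n i j (r + 1))
        - (T n i j r * T n h k (s + 1) - T n h k (s + 1) * T n i j r)
      = T n h j r * T n i k s - T n h j s * T n i k r := by
  have := RingQuot.mkAlgHom_rel ℂ (Rel.rtt (n := n) i j h k r s)
  simp only [map_sub, map_mul] at this
  exact this

/-- The universal property of the presentation: elements `t i j r` of an algebra with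
`t i j 0 = δ_{i,j}` that satisfy the RTT relations define a homomorphism from `Y_n`. -/
def lift {n : ℕ} {B : Type*} [Ring B] [Algebra ℂ B] (t : Fin n → Fin n → ℕ → B)
    (h0 : ∀ i j, t i j 0 = if i = j then 1 else 0)
    (hrel : ∀ (i j h k : Fin n) (r s : ℕ),
      (t i j (r + 1) * t h k s - t h k s * t i j (r + 1))
          - (t i j r * t h k (s + 1) - t h k (s + 1) * t i j r)
        = t h j r * t i k s - t h j s * t i k r) : Yangian n →ₐ[ℂ] B :=
  RingQuot.liftAlgHom ℂ ⟨FreeAlgebra.lift ℂ (fun x => t x.1 x.2.1 (x.2.2 + 1)), by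
    have ht : ∀ i j r, FreeAlgebra.lift ℂ (fun x : Fin n × Fin n × ℕ => t x.1 x.2.1 (x.2.2 + 1))
        (freeT n i j r) = t i j r := by
      intro i j r
      cases r with
      | zero => rw [h0, freeT]; split_ifs <;> simp
      | succ r => simp [freeT]
    rintro _ _ ⟨i, j, h, k, r, s⟩
    simp only [map_sub, map_mul, ht]
    exact hrel i j h k r s⟩

theorem lift_T {n : ℕ} {B : Type*} [Ring B] [Algebra ℂ B] (t : Fin n → Fin n → ℕ → B) (h0 hrel)
    (i j : Fin n) (r : ℕ) : lift t h0 hrel (T n i j r) = t i j r := by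
  have h : lift t h0 hrel (T n i j r)
      = FreeAlgebra.lift ℂ (fun x : Fin n × Fin n × ℕ => t x.1 x.2.1 (x.2.2 + 1))
        (freeT n i j r) :=
    RingQuot.liftAlgHom_mkAlgHom_apply ℂ _ _ _
  rw [h]
  cases r with
  | zero => rw [h0, freeT]; split_ifs <;> simp
  | succ r => simp [freeT]

/-- The homomorphism `Y_k → Y_l` with `T_{i,j}^{(r)} ↦ T_{f i, f j}^{(r)}`, for `f` injective. -/
def embed {k l : ℕ} (f : Fin k ↪ Fin l) : Yangian k →ₐ[ℂ] Yangian l :=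
  lift (fun i j r => T l (f i) (f j) r)
    (fun i j => by simp [T_zero])
    (fun i j h k r s => T_rel l (f i) (f j) (f h) (f k) r s)

/-- The standard embedding `Y_m → Y_{m+n}`, `T_{i,j}^{(r)} ↦ T_{i,j}^{(r)}`. -/
def stdEmb (m n : ℕ) : Yangian m →ₐ[ℂ] Yangian (m + n) := embed (Fin.castAddEmb n)

/-- The map `φ_m : Y_n → Y_{m+n}`, `T_{i,j}^{(r)} ↦ T_{m+i,m+j}^{(r)}`. -/
def phi (m n : ℕ) : Yangian n →ₐ[ℂ] Yangian (m + n) := embed (Fin.natAddEmb m)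

/-- The matrix `T(-u)`, as a power series in `u^{-1}` with coefficients in the `n × n` matrices
over `Y_n`. -/
def Tneg (n : ℕ) : PowerSeries (Matrix (Fin n) (Fin n) (Yangian n)) :=
  PowerSeries.mk fun r => Matrix.of fun i j => (-1) ^ r * T n i j r

/-- The inverse matrix `T(-u)^{-1}`. -/
def TnegInv (n : ℕ) : PowerSeries (Matrix (Fin n) (Fin n) (Yangian n)) :=
  PowerSeries.invOfUnit (Tneg n) 1

theorem coeff_zero_Tneg (n : ℕ) : PowerSeries.coeff 0 (Tneg n) = 1 := by
  ext i j
  simp [Tneg, T_zero, Matrix.one_apply]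

theorem Tneg_mul_TnegInv (n : ℕ) : Tneg n * TnegInv n = 1 :=
  PowerSeries.mul_invOfUnit _ _ (by
    rw [← PowerSeries.coeff_zero_eq_constantCoeff_apply, coeff_zero_Tneg]; rfl)

theorem TnegInv_mul_Tneg (n : ℕ) : TnegInv n * Tneg n = 1 :=
  PowerSeries.invOfUnit_mul _ _ (by
    rw [← PowerSeries.coeff_zero_eq_constantCoeff_apply, coeff_zero_Tneg]; rfl)

/-- `M ↦ M ⊗ 1`, with entry `M_{i,j} δ_{h,k}` at `((i,h),(j,k))`. -/
def leg1 (n : ℕ) (B : Type*) [Ring B] :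
    Matrix (Fin n) (Fin n) B →+* Matrix (Fin n × Fin n) (Fin n × Fin n) B where
  toFun M := Matrix.of fun a b => if a.2 = b.2 then M a.1 b.1 else 0
  map_one' := by ext ⟨i, h⟩ ⟨j, k⟩; simp [Matrix.one_apply]; grind
  map_mul' M N := by
    ext ⟨i, h⟩ ⟨j, k⟩
    simp [Matrix.mul_apply, Fintype.sum_prod_type]
  map_zero' := by ext; simp
  map_add' M N := by ext ⟨i, h⟩ ⟨j, k⟩; simp; grind

/-- `M ↦ 1 ⊗ M`, with entry `δ_{i,j} M_{h,k}` at `((i,h),(j,k))`. -/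
def leg2 (n : ℕ) (B : Type*) [Ring B] :
    Matrix (Fin n) (Fin n) B →+* Matrix (Fin n × Fin n) (Fin n × Fin n) B where
  toFun M := Matrix.of fun a b => if a.1 = b.1 then M a.2 b.2 else 0
  map_one' := by ext ⟨i, h⟩ ⟨j, k⟩; simp [Matrix.one_apply]; grind
  map_mul' M N := by
    ext ⟨i, h⟩ ⟨j, k⟩
    simp [Matrix.mul_apply, Fintype.sum_prod_type]
  map_zero' := by ext; simp
  map_add' M N := by ext ⟨i, h⟩ ⟨j, k⟩; simp; grind

/-- The flip `∑ e_{i,j} ⊗ e_{j,i}`. -/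
def flip (n : ℕ) (B : Type*) [Ring B] : Matrix (Fin n × Fin n) (Fin n × Fin n) B :=
  Matrix.of fun a b => if a.1 = b.2 ∧ a.2 = b.1 then 1 else 0

theorem flip_mul (n : ℕ) (B : Type*) [Ring B] (M : Matrix (Fin n × Fin n) (Fin n × Fin n) B)
    (i h j k : Fin n) : (flip n B * M) (i, h) (j, k) = M (h, i) (j, k) := by
  simp only [flip, Matrix.mul_apply, Matrix.of_apply, Fintype.sum_prod_type, ite_mul, one_mul,
    zero_mul, ite_and]
  simp

theorem mul_flip (n : ℕ) (B : Type*) [Ring B] (M : Matrix (Fin n × Fin n) (Fin n × Fin n) B)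
    (i h j k : Fin n) : (M * flip n B) (i, h) (j, k) = M (i, h) (k, j) := by
  simp only [flip, Matrix.mul_apply, Matrix.of_apply, Fintype.sum_prod_type, mul_ite, mul_one,
    mul_zero, ite_and]
  simp

theorem leg1_mul_leg2 (n : ℕ) (B : Type*) [Ring B] (M N : Matrix (Fin n) (Fin n) B)
    (i h j k : Fin n) : (leg1 n B M * leg2 n B N) (i, h) (j, k) = M i j * N h k := by
  simp [leg1, leg2, Matrix.mul_apply, Fintype.sum_prod_type]

theorem leg2_mul_leg1 (n : ℕ) (B : Type*) [Ring B] (M N : Matrix (Fin n) (Fin n) B)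
    (i h j k : Fin n) : (leg2 n B N * leg1 n B M) (i, h) (j, k) = N h k * M i j := by
  simp [leg1, leg2, Matrix.mul_apply, Fintype.sum_prod_type]

/-- The coefficients of the entries of `T(-u)^{-1}` satisfy the RTT relations. -/
theorem TnegInv_rel (n : ℕ) (i j h k : Fin n) (r s : ℕ) :
    let S : Fin n → Fin n → ℕ → Yangian n := fun i j r => PowerSeries.coeff r (TnegInv n) i j
    (S i j (r + 1) * S h k s - S h k s * S i j (r + 1))
        - (S i j r * S h k (s + 1) - S h k (s + 1) * S i j r)
      = S h j r * S i k s - S h j s * S i k r := by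
  intro S
  have main := rtt_inverse (-flip n (Yangian n))
    (PowerSeries.map (leg1 n (Yangian n)) (Tneg n))
    (PowerSeries.map (leg2 n (Yangian n)) (Tneg n))
    (PowerSeries.map (leg1 n (Yangian n)) (TnegInv n))
    (PowerSeries.map (leg2 n (Yangian n)) (TnegInv n))
    (by rw [PowerSeries.coeff_map, coeff_zero_Tneg, map_one])
    (by rw [PowerSeries.coeff_map, coeff_zero_Tneg, map_one])
    (by rw [← map_mul, Tneg_mul_TnegInv, map_one])
    (by rw [← map_mul, TnegInv_mul_Tneg, map_one])
    (by rw [← map_mul, Tneg_mul_TnegInv, map_one])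
    (by rw [← map_mul, TnegInv_mul_Tneg, map_one])
    (by
      intro r s
      ext ⟨i, h⟩ ⟨j, k⟩
      have e := T_rel n i j h k r s
      have sgn : ∀ (a b : ℕ) (x y : Yangian n),
          ((-1) ^ a * x) * ((-1) ^ b * y) = (-1) ^ (a + b) * (x * y) := by
        intro a b x y
        have : Commute x ((-1 : Yangian n) ^ b) := (Commute.neg_one_right x).pow_right b
        rw [pow_add, mul_assoc, ← mul_assoc x, this.eq]
        simp only [mul_assoc]
      simp only [PowerSeries.coeff_map, neg_mul, mul_neg, Matrix.sub_apply, Matrix.neg_apply,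
        mul_assoc, leg1_mul_leg2, leg2_mul_leg1, flip_mul]
      rw [← mul_assoc, mul_flip, leg2_mul_leg1]
      simp only [Tneg, PowerSeries.coeff_mk, Matrix.of_apply, sgn]
      have e' := congrArg (fun z => (-1 : Yangian n) ^ (r + s + 1) * z) e
      simp only [mul_sub] at e'
      rw [show r + 1 + s = r + s + 1 by ring, show s + (r + 1) = r + s + 1 by ring,
        show r + (s + 1) = r + s + 1 by ring, show s + 1 + r = r + s + 1 by ring,
        show s + r = r + s by ring, e']
      rw [pow_succ]
      noncomm_ring)
    s r
  have e := congrFun (congrFun main (h, i)) (k, j)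
  simp only [PowerSeries.coeff_map, neg_mul, mul_neg, Matrix.sub_apply, Matrix.neg_apply,
        mul_assoc, leg1_mul_leg2, leg2_mul_leg1, flip_mul] at e
  rw [← mul_assoc, mul_flip, leg1_mul_leg2] at e
  simp only [S]
  rw [← sub_eq_zero] at e ⊢
  rw [← e]
  noncomm_ring

/-- The homomorphism `ω = ω_n : Y_n → Y_n` with `ω(T(u)) = T(-u)^{-1}`, i.e. it maps
`T_{i,j}^{(r)}` to the `u^{-r}`-coefficient of the `(i,j)`-entry of `T(-u)^{-1}`. -/
def omega (n : ℕ) : Yangian n →ₐ[ℂ] Yangian n :=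
  lift (fun i j r => PowerSeries.coeff r (TnegInv n) i j)
    (fun i j => by
      simp [TnegInv, Matrix.one_apply])
    (fun i j h k r s => TnegInv_rel n i j h k r s)

/-- The map `ψ_m = ω_{m+n} ∘ φ_m ∘ ω_n : Y_n → Y_{m+n}`. -/
def psi (m n : ℕ) : Yangian n →ₐ[ℂ] Yangian (m + n) :=
  (omega (m + n)).comp ((phi m n).comp (omega n))

end Yangian

end

/-! Filter `Y_N` by giving `T_{i,j}^{(r)}` degree `2r - 1`. In the commutator of `T_{i,j}^{(r+1)}`
and `T_{h,k}^{(s+1)}` the linear terms have degree `2(r+s) + 1`, the quadratic ones at most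
`2(r+s)`, and the product itself `2(r+s) + 2`. Hence the associated graded algebra is commutative,
and the top part of the commutator is the Lie bracket of `𝔤𝔩_N[t]`. So the graded algebra is the
symmetric algebra of `𝔤𝔩_N[t]` with its Poisson bracket, here the polynomial ring on `Idx N`. The
relation `Sym` pairs an element with its symbol. That symbols are unique is the PBW theorem
`eq_zero_of_zero_mem_Sym`, proved by letting `Y_N` act on tensor products of evaluation modules with
enough free parameters to separate polynomials.

If `x` centralizes `Y_m`, its symbol `P` Poisson commutes with all coordinates of the upper left
block. Bracketing with coordinates of arbitrarily high degree in `t` turns this into linear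
identities between partial derivatives of `P`. These force `P` to be a polynomial in the lower right
block and the traces of the upper left block (`mem_adjoin_of_poisson_eq_zero`).

Both kinds of variables are symbols of elements of the product. The lower right coordinates come
from `psi m n`, whose image commutes with `Y_m` because entries of `T(u)` and `T(v)⁻¹` with disjoint
block indices commute (`stdEmb_comm_psi`). The traces come from central elements of `Y_m`: the
coefficients of the trace of `T(u - m)⁻¹ T(u)` (`IsRTT.shiftTrace_comm`, `exists_center_mem_Sym`).
Subtracting an element of the product with symbol `P` lowers the degree of `x` and keeps it in the
centralizer, so induction on the degree finishes the proof. -/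

noncomputable section

namespace Yangian

/-! ### The filtration of the Yangian and symbols in the polynomial ring. -/

section

open MvPolynomial

variable {n : ℕ}

/-- The index set of the generators `T_{i,j}^{(r+1)}` of `Y_n`. -/
abbrev Idx (n : ℕ) : Type := Fin n × Fin n × ℕ

/-- The generator `T_{i,j}^{(r+1)}`. -/
def gen (v : Idx n) : Yangian n := T n v.1 v.2.1 (v.2.2 + 1)

theorem mk_surjective (n : ℕ) : Function.Surjective (mk n) :=
  RingQuot.mkAlgHom_surjective ℂ (Rel n)

theorem adjoin_gen (n : ℕ) : Algebra.adjoin ℂ (Set.range (gen (n := n))) = ⊤ := by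
  have h : Set.range (gen (n := n)) = mk n '' Set.range (FreeAlgebra.ι ℂ) := by
    rw [← Set.range_comp]; rfl
  rw [h, ← AlgHom.map_adjoin, FreeAlgebra.adjoin_range_ι, Algebra.map_top,
    AlgHom.range_eq_top]
  exact mk_surjective n

/-- The filtration degree `2r - 1` of `T_{i,j}^{(r)}`. -/
def wt (v : Idx n) : ℕ := 2 * v.2.2 + 1

/-- The product of a list of generators. -/
def word (l : List (Idx n)) : Yangian n := (l.map gen).prod

/-- The degree of a product of generators. -/
def wtl (l : List (Idx n)) : ℕ := (l.map wt).sum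

/-- The monomial that is the symbol of a product of generators. -/
def mon (l : List (Idx n)) : MvPolynomial (Idx n) ℂ := (l.map X).prod

@[simp] theorem word_nil : word (n := n) [] = 1 := rfl
@[simp] theorem wtl_nil : wtl (n := n) [] = 0 := rfl
@[simp] theorem mon_nil : mon (n := n) [] = 1 := rfl
@[simp] theorem word_cons (v : Idx n) (l) : word (v :: l) = gen v * word l := by simp [word]
@[simp] theorem wtl_cons (v : Idx n) (l) : wtl (v :: l) = wt v + wtl l := by simp [wtl]
@[simp] theorem mon_cons (v : Idx n) (l) : mon (v :: l) = X v * mon l := by simp [mon]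
theorem word_append (l l' : List (Idx n)) : word (l ++ l') = word l * word l' := by simp [word]
theorem wtl_append (l l' : List (Idx n)) : wtl (l ++ l') = wtl l + wtl l' := by simp [wtl]
theorem mon_append (l l' : List (Idx n)) : mon (l ++ l') = mon l * mon l' := by simp [mon]

/-- The span of the products of generators of degree less than `d`. -/
def Flt (n d : ℕ) : Submodule ℂ (Yangian n) := Submodule.span ℂ {x | ∃ l, wtl l < d ∧ word l = x}

theorem word_mem_Flt {l : List (Idx n)} {d : ℕ} (h : wtl l < d) : word l ∈ Flt n d :=
  Submodule.subset_span ⟨l, h, rfl⟩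

theorem Flt_induction {d : ℕ} (S : Submodule ℂ (Yangian n)) (h : ∀ l, wtl l < d → word l ∈ S) :
    Flt n d ≤ S := by
  rw [Flt, Submodule.span_le]
  rintro _ ⟨l, hl, rfl⟩
  exact h l hl

theorem Flt_mono {d e : ℕ} (h : d ≤ e) : Flt n d ≤ Flt n e :=
  Flt_induction _ fun _ hl => word_mem_Flt (hl.trans_le h)

theorem Flt_zero : Flt n 0 = ⊥ :=
  le_bot_iff.1 (Flt_induction _ fun _ hl => absurd hl (Nat.not_lt_zero _))

/-- `Flt` bounds degrees strictly: degrees at most `p - 1` and `q - 1` add up to something less than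
`p + q - 1`. -/
theorem mul_mem_Flt {p q r : ℕ} {x y : Yangian n} (hx : x ∈ Flt n p) (hy : y ∈ Flt n q)
    (h : p + q ≤ r + 1) : x * y ∈ Flt n r := by
  refine (Flt_induction ((Flt n r).comap (LinearMap.mulRight ℂ y)) fun l hl => ?_) hx
  refine (Flt_induction ((Flt n r).comap (LinearMap.mulLeft ℂ (word l))) fun l' hl' => ?_) hy
  simp only [Submodule.mem_comap, LinearMap.mulLeft_apply, ← word_append]
  exact word_mem_Flt (by rw [wtl_append]; omega)

theorem one_mem_Flt {d : ℕ} (h : 0 < d) : (1 : Yangian n) ∈ Flt n d :=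
  word_mem_Flt (l := []) h

theorem gen_mem_Flt (v : Idx n) {d : ℕ} (h : wt v < d) : gen v ∈ Flt n d := by
  have := word_mem_Flt (l := [v]) (d := d) (by simpa using h)
  simpa using this

theorem T_succ_mem_Flt (i j : Fin n) (r : ℕ) {d : ℕ} (h : 2 * r + 1 < d) :
    T n i j (r + 1) ∈ Flt n d := gen_mem_Flt (i, j, r) h

theorem exists_mem_Flt (x : Yangian n) : ∃ d, x ∈ Flt n d := by
  have hx : x ∈ Algebra.adjoin ℂ (Set.range (gen (n := n))) := by rw [adjoin_gen]; trivial
  induction hx using Algebra.adjoin_induction with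
  | mem x hx => obtain ⟨v, rfl⟩ := hx; exact ⟨_, gen_mem_Flt v (Nat.lt_succ_self _)⟩
  | algebraMap c =>
    refine ⟨1, ?_⟩
    rw [Algebra.algebraMap_eq_smul_one]
    exact Submodule.smul_mem _ _ (one_mem_Flt one_pos)
  | add x y _ _ hx hy =>
    obtain ⟨d, hd⟩ := hx
    obtain ⟨e, he⟩ := hy
    exact ⟨d + e, add_mem (Flt_mono (by omega) hd) (Flt_mono (by omega) he)⟩
  | mul x y _ _ hx hy =>
    obtain ⟨d, hd⟩ := hx
    obtain ⟨e, he⟩ := hy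
    exact ⟨d + e, mul_mem_Flt hd he (by omega)⟩

/-- The linear part of the commutator of `T_{i,j}^{(r+1)}` and `T_{h,k}^{(s+1)}`. -/
def brk (i j : Fin n) (r : ℕ) (v : Idx n) : MvPolynomial (Idx n) ℂ :=
  (if v.1 = j then X (i, v.2.1, r + v.2.2) else 0)
    - (if i = v.2.1 then X (v.1, j, r + v.2.2) else 0)

/-- Each use of the RTT relation moves one unit of the upper index from the first factor to the
second, at the cost of a quadratic term of degree `2(r+s)`. When the first index has dropped to `1`,
the commutator is exactly linear. -/
theorem T_comm_sub_mem (i j h k : Fin n) (r s : ℕ) :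
    T n i j (r + 1) * T n h k (s + 1) - T n h k (s + 1) * T n i j (r + 1)
      - ((if h = j then T n i k (r + s + 1) else 0) - (if i = k then T n h j (r + s + 1) else 0))
      ∈ Flt n (2 * (r + s) + 1) := by
  induction r generalizing s with
  | zero =>
    have := T_rel n i j h k 0 (s + 1)
    simp only [T_zero] at this
    rw [show T n i j (0 + 1) * T n h k (s + 1) - T n h k (s + 1) * T n i j (0 + 1)
        = (if h = j then T n i k (0 + s + 1) else 0)
          - (if i = k then T n h j (0 + s + 1) else 0) by
      rw [zero_add s]
      split_ifs at this ⊢ <;> simp at this ⊢ <;> exact this]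
    rw [sub_self]
    exact zero_mem _
  | succ r ih =>
    have h1 := T_rel n i j h k (r + 1) (s + 1)
    have h2 := ih (s + 1)
    rw [show r + (s + 1) = r + 1 + s by ring] at h2
    have h3 : T n h j (r + 1) * T n i k (s + 1) - T n h j (s + 1) * T n i k (r + 1)
        ∈ Flt n (2 * (r + 1 + s) + 1) := by
      refine sub_mem ?_ ?_
      · exact mul_mem_Flt (T_succ_mem_Flt h j r (Nat.lt_succ_self _))
          (T_succ_mem_Flt i k s (Nat.lt_succ_self _)) (by omega)
      · exact mul_mem_Flt (T_succ_mem_Flt h j s (Nat.lt_succ_self _))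
          (T_succ_mem_Flt i k r (Nat.lt_succ_self _)) (by omega)
    have := add_mem h3 h2
    rw [← h1] at this
    convert this using 1
    abel

/-- The strict bound says that commuting two generators loses at least one degree, so the graded
algebra is commutative. -/
theorem gen_comm_mem (v w : Idx n) :
    gen v * gen w - gen w * gen v ∈ Flt n (wt v + wt w) := by
  obtain ⟨i, j, r⟩ := v
  obtain ⟨h, k, s⟩ := w
  have h1 := Flt_mono (show 2 * (r + s) + 1 ≤ wt (i, j, r) + wt (h, k, s) by simp only [wt]; omega)
    (T_comm_sub_mem i j h k r s)
  have h2 : ((if h = j then T n i k (r + s + 1) else 0)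
      - (if i = k then T n h j (r + s + 1) else 0)) ∈ Flt n (wt (i, j, r) + wt (h, k, s)) := by
    refine sub_mem ?_ ?_ <;> split_ifs
    any_goals exact zero_mem _
    all_goals exact T_succ_mem_Flt _ _ _ (by simp only [wt]; omega)
  have := add_mem h1 h2
  rwa [sub_add_cancel] at this

theorem gen_comm_word_mem (v : Idx n) (l : List (Idx n)) :
    gen v * word l - word l * gen v ∈ Flt n (wtl l + wt v) := by
  induction l with
  | nil => simp
  | cons w l ih =>
    have h1 := mul_mem_Flt (r := wtl (w :: l) + wt v) (gen_comm_mem v w)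
      (word_mem_Flt (l := l) (Nat.lt_succ_self _)) (by simp only [wtl_cons]; omega)
    have h2 := mul_mem_Flt (r := wtl (w :: l) + wt v) (gen_mem_Flt w (Nat.lt_succ_self _)) ih
      (by simp only [wtl_cons]; omega)
    have := add_mem h1 h2
    convert this using 1
    rw [word_cons]
    noncomm_ring

theorem gen_comm_mem_Flt (v : Idx n) {d : ℕ} {x : Yangian n} (hx : x ∈ Flt n d) :
    gen v * x - x * gen v ∈ Flt n (d + 2 * v.2.2) := by
  refine (Flt_induction ((Flt n (d + 2 * v.2.2)).comap
    (LinearMap.mulLeft ℂ (gen v) - LinearMap.mulRight ℂ (gen v))) fun l hl => ?_) hx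
  exact Flt_mono (by simp only [wt]; omega) (gen_comm_word_mem v l)

theorem wtl_perm {l l' : List (Idx n)} (h : l.Perm l') : wtl l = wtl l' :=
  (h.map wt).sum_eq

theorem word_perm {l l' : List (Idx n)} (h : l.Perm l') : word l - word l' ∈ Flt n (wtl l) := by
  induction h with
  | nil => simp
  | @cons w l l' hp ih =>
    rw [word_cons, word_cons, ← mul_sub]
    exact mul_mem_Flt (gen_mem_Flt w (Nat.lt_succ_self _)) ih (by simp only [wtl_cons]; omega)
  | swap v w l =>
    have := mul_mem_Flt (r := wtl (w :: v :: l)) (gen_comm_mem w v)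
      (word_mem_Flt (l := l) (Nat.lt_succ_self _)) (by simp only [wtl_cons]; omega)
    simp only [word_cons, ← mul_assoc, ← sub_mul]
    exact this
  | @trans l l' l'' h1 h2 ih1 ih2 =>
    rw [← wtl_perm h1] at ih2
    have := add_mem ih1 ih2
    rwa [sub_add_sub_cancel] at this

/-- The pairs `(x, P)` such that `x` has degree at most `d`, and `P` is its symbol of degree `d`. -/
def Sym (n d : ℕ) : Submodule ℂ (Yangian n × MvPolynomial (Idx n) ℂ) :=
  Submodule.span ℂ ({a | ∃ l, wtl l = d ∧ (word l, mon l) = a}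
    ∪ {a | ∃ l, wtl l < d ∧ (word l, 0) = a})

theorem Sym_induction {d : ℕ} (S : Submodule ℂ (Yangian n × MvPolynomial (Idx n) ℂ))
    (h : ∀ l, wtl l = d → (word l, mon l) ∈ S) (h' : ∀ l, wtl l < d → (word l, 0) ∈ S) :
    Sym n d ≤ S := by
  rw [Sym, Submodule.span_le]
  rintro _ (⟨l, hl, rfl⟩ | ⟨l, hl, rfl⟩)
  · exact h l hl
  · exact h' l hl

theorem word_mon_mem_Sym {l : List (Idx n)} {d : ℕ} (h : wtl l = d) : (word l, mon l) ∈ Sym n d :=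
  Submodule.subset_span (Or.inl ⟨l, h, rfl⟩)

theorem gen_X_mem_Sym (v : Idx n) : (gen v, X v) ∈ Sym n (wt v) := by
  have := word_mon_mem_Sym (l := [v]) rfl
  simpa using this

theorem one_mem_Sym : ((1 : Yangian n), 1) ∈ Sym n 0 := by
  simpa using word_mon_mem_Sym (n := n) (l := []) rfl

theorem mem_Sym_of_mem_Flt {d : ℕ} {x : Yangian n} (hx : x ∈ Flt n d) : (x, 0) ∈ Sym n d :=
  (Flt_induction ((Sym n d).comap (LinearMap.inl ℂ _ _))
    fun l hl => Submodule.subset_span (Or.inr ⟨l, hl, rfl⟩)) hx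

theorem exists_mem_Sym {d : ℕ} {x : Yangian n} (hx : x ∈ Flt n (d + 1)) :
    ∃ P, (x, P) ∈ Sym n d := by
  have := (Flt_induction ((Sym n d).map (LinearMap.fst ℂ _ _)) fun l hl => ?_) hx
  · obtain ⟨⟨y, P⟩, h, rfl⟩ := this
    exact ⟨P, h⟩
  · rcases (Nat.lt_succ_iff.1 hl).lt_or_eq with hl | hl
    · exact ⟨(word l, 0), mem_Sym_of_mem_Flt (word_mem_Flt hl), rfl⟩
    · exact ⟨_, word_mon_mem_Sym hl, rfl⟩

theorem mem_Flt_of_mem_Sym {d : ℕ} {x : Yangian n} {P} (h : (x, P) ∈ Sym n d) :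
    x ∈ Flt n (d + 1) := by
  refine (Sym_induction ((Flt n (d + 1)).comap (LinearMap.fst ℂ _ _)) ?_ ?_) h
  · exact fun l hl => word_mem_Flt (by omega)
  · exact fun l hl => word_mem_Flt (by omega)

theorem isWeightedHomogeneous_of_mem_Sym {d : ℕ} {x : Yangian n} {P} (h : (x, P) ∈ Sym n d) :
    IsWeightedHomogeneous wt P d := by
  refine (Sym_induction ((weightedHomogeneousSubmodule ℂ wt d).comap (LinearMap.snd ℂ _ _)) ?_
    fun l _ => Submodule.zero_mem (weightedHomogeneousSubmodule ℂ wt d)) h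
  rintro l rfl
  clear h
  change IsWeightedHomogeneous wt (mon l) (wtl l)
  induction l with
  | nil => exact isWeightedHomogeneous_one ℂ wt
  | cons v l ih => exact (isWeightedHomogeneous_X ℂ wt v).mul ih

theorem mul_mem_Sym {d e : ℕ} {x y : Yangian n} {P Q} (hx : (x, P) ∈ Sym n d)
    (hy : (y, Q) ∈ Sym n e) : (x * y, P * Q) ∈ Sym n (d + e) := by
  have h0 : ∀ {u v : Yangian n} {a b : ℕ}, u ∈ Flt n a → v ∈ Flt n b → a + b ≤ d + e + 1 →
      (u * v, 0) ∈ Sym n (d + e) := fun hu hv h => mem_Sym_of_mem_Flt (mul_mem_Flt hu hv h)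
  refine (Sym_induction ((Sym n (d + e)).comap
    ((LinearMap.mulRight ℂ y).prodMap (LinearMap.mulRight ℂ Q))) ?_ ?_) hx
  · intro l hl
    refine (Sym_induction ((Sym n (d + e)).comap
      ((LinearMap.mulLeft ℂ (word l)).prodMap (LinearMap.mulLeft ℂ (mon l)))) ?_ ?_) hy
    · intro l' hl'
      simp only [Submodule.mem_comap, LinearMap.prodMap_apply, LinearMap.mulLeft_apply,
        ← word_append, ← mon_append]
      exact word_mon_mem_Sym (by rw [wtl_append, hl, hl'])
    · intro l' hl'
      simp only [Submodule.mem_comap, LinearMap.prodMap_apply, LinearMap.mulLeft_apply, mul_zero]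
      exact h0 (word_mem_Flt (Nat.lt_succ_self _)) (word_mem_Flt hl') (by omega)
  · intro l hl
    simp only [Submodule.mem_comap, LinearMap.prodMap_apply, LinearMap.mulRight_apply, zero_mul]
    exact h0 (word_mem_Flt hl) (mem_Flt_of_mem_Sym hy) (by omega)

/-- The Poisson bracket with the coordinate `X (i, j, r)`. -/
def poisson (i j : Fin n) (r : ℕ) :
    Derivation ℂ (MvPolynomial (Idx n) ℂ) (MvPolynomial (Idx n) ℂ) :=
  mkDerivation ℂ (brk i j r)

theorem gen_comm_mem_Sym (i j : Fin n) (r : ℕ) (v : Idx n) :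
    (gen (i, j, r) * gen v - gen v * gen (i, j, r), brk i j r v) ∈ Sym n (wt v + 2 * r) := by
  obtain ⟨h, k, s⟩ := v
  have h1 := mem_Sym_of_mem_Flt (Flt_mono (show 2 * (r + s) + 1 ≤ wt (h, k, s) + 2 * r by
    simp only [wt]; omega) (T_comm_sub_mem i j h k r s))
  have h2 : ((if h = j then T n i k (r + s + 1) else 0)
      - (if i = k then T n h j (r + s + 1) else 0), brk i j r (h, k, s))
      ∈ Sym n (wt (h, k, s) + 2 * r) := by
    have e : wt (h, k, s) + 2 * r = 2 * (r + s) + 1 := by simp only [wt]; ring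
    rw [brk, e]
    have a : ∀ (p : Prop) [Decidable p] (b c : Fin n), ((if p then T n b c (r + s + 1) else 0),
        (if p then (X (b, c, r + s) : MvPolynomial (Idx n) ℂ) else 0)) ∈ Sym n (2 * (r + s) + 1) := by
      intro p _ b c
      split_ifs
      · exact gen_X_mem_Sym (b, c, r + s)
      · exact zero_mem _
    exact sub_mem (a (h = j) i k) (a (i = k) h j)
  have := add_mem h1 h2
  rwa [Prod.mk_add_mk, sub_add_cancel, zero_add] at this

/-- The commutator with a generator and the Poisson bracket both obey the Leibniz rule, so agreement
on generators suffices. The degree rises by `2r`, one less than the degree of the generator. -/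
theorem comm_mem_Sym (i j : Fin n) (r : ℕ) {d : ℕ} {x : Yangian n} {P} (hx : (x, P) ∈ Sym n d) :
    (gen (i, j, r) * x - x * gen (i, j, r), poisson i j r P) ∈ Sym n (d + 2 * r) := by
  refine (Sym_induction ((Sym n (d + 2 * r)).comap
    ((LinearMap.mulLeft ℂ (gen (i, j, r)) - LinearMap.mulRight ℂ (gen (i, j, r))).prodMap
      (poisson i j r : MvPolynomial (Idx n) ℂ →ₗ[ℂ] MvPolynomial (Idx n) ℂ))) ?_ ?_) hx
  · rintro l rfl
    clear hx
    change (gen (i, j, r) * word l - word l * gen (i, j, r), poisson i j r (mon l)) ∈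
      Sym n (wtl l + 2 * r)
    induction l with
    | nil =>
      simp only [word_nil, mul_one, one_mul, sub_self, mon_nil, Derivation.map_one_eq_zero]
      exact Submodule.zero_mem _
    | cons v l ih =>
      have h1 := mul_mem_Sym (gen_comm_mem_Sym i j r v) (word_mon_mem_Sym (l := l) rfl)
      have h2 := mul_mem_Sym (gen_X_mem_Sym v) ih
      rw [show wt v + 2 * r + wtl l = wtl (v :: l) + 2 * r by rw [wtl_cons]; ring] at h1
      rw [show wt v + (wtl l + 2 * r) = wtl (v :: l) + 2 * r by rw [wtl_cons]; ring] at h2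
      convert add_mem h1 h2 using 1
      rw [Prod.mk_add_mk]
      congr 1
      · rw [word_cons]; noncomm_ring
      · rw [mon_cons, Derivation.leibniz, poisson, mkDerivation_X]
        simp only [smul_eq_mul]
        ring
  · intro l hl
    simp only [Submodule.mem_comap, LinearMap.prodMap_apply, map_zero]
    exact mem_Sym_of_mem_Flt (gen_comm_mem_Flt (i, j, r) (word_mem_Flt hl))

/-- A linear section of the symbol map: each monomial is sent to a product of generators in some
order. -/
def symbolSection (n : ℕ) : MvPolynomial (Idx n) ℂ →ₗ[ℂ] Yangian n :=
  (basisMonomials (Idx n) ℂ).constr ℂ fun s => word (Finsupp.toMultiset s).toList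

theorem mon_eq_monomial (l : List (Idx n)) :
    mon l = monomial (Multiset.toFinsupp (l : Multiset (Idx n))) 1 := by
  classical
  induction l with
  | nil => simp
  | cons v l ih =>
    rw [mon_cons, ih, X, monomial_mul, one_mul, ← Multiset.cons_coe, ← Multiset.singleton_add,
      map_add, Multiset.toFinsupp_singleton]

theorem symbolSection_mon (l : List (Idx n)) : word l - symbolSection n (mon l) ∈ Flt n (wtl l) := by
  have : symbolSection n (mon l) = word (l : Multiset (Idx n)).toList := by
    rw [mon_eq_monomial]
    have := (basisMonomials (Idx n) ℂ).constr_basis ℂ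
      (fun s => word (Finsupp.toMultiset s).toList) (Multiset.toFinsupp (l : Multiset (Idx n)))
    rw [coe_basisMonomials] at this
    rw [symbolSection, this, Multiset.toFinsupp_toMultiset]
  rw [this]
  refine word_perm (Multiset.coe_eq_coe.1 ?_)
  rw [Multiset.coe_toList]

theorem sub_symbolSection_mem {d : ℕ} {x : Yangian n} {P} (hx : (x, P) ∈ Sym n d) :
    x - symbolSection n P ∈ Flt n d := by
  refine (Sym_induction ((Flt n d).comap
    (LinearMap.fst ℂ _ _ - (symbolSection n).comp (LinearMap.snd ℂ _ _))) ?_ ?_) hx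
  · rintro l rfl
    exact symbolSection_mon l
  · intro l hl
    simpa using word_mem_Flt hl

/-- Commutativity of the graded algebra is enough here, without PBW: modulo lower degree, an element
is recovered from its symbol by `symbolSection`, and this map sends `0` to `0`. -/
theorem mem_Flt_of_mem_Sym_zero {d : ℕ} {x : Yangian n} (hx : (x, 0) ∈ Sym n d) :
    x ∈ Flt n d := by
  simpa using sub_symbolSection_mem hx

end

/-! ### Formal series in two variables `x = u⁻¹` and `y = v⁻¹`. -/

section Series

open PowerSeries

variable {B : Type*} [Ring B]

/-- The power series `∑ e_{a,b} x^a y^b`. -/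
def biSeries (e : ℕ → ℕ → B) : PowerSeries (PowerSeries B) :=
  PowerSeries.mk fun b => PowerSeries.mk fun a => e a b

/-- The power series `∑ f_a x^a` in the first variable. -/
def serX (f : ℕ → B) : PowerSeries (PowerSeries B) := C (PowerSeries.mk f)

/-- The power series `∑ f_b y^b` in the second variable. -/
def serY (f : ℕ → B) : PowerSeries (PowerSeries B) := PowerSeries.mk fun b => C (f b)

theorem coeff_coeff_biSeries (e : ℕ → ℕ → B) (a b : ℕ) :
    coeff a (coeff b (biSeries e)) = e a b := by simp [biSeries]

theorem serX_mul_serY (f g : ℕ → B) : serX f * serY g = biSeries fun a b => f a * g b := by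
  ext b a
  simp [serX, serY, biSeries, coeff_C_mul, coeff_mul_C]

theorem serY_mul_serX (f g : ℕ → B) : serY g * serX f = biSeries fun a b => g b * f a := by
  ext b a
  simp [serX, serY, biSeries, coeff_C_mul, coeff_mul_C]

theorem biSeries_sub (e g : ℕ → ℕ → B) :
    biSeries e - biSeries g = biSeries fun a b => e a b - g a b := by
  ext b a; simp [biSeries]

theorem biSeries_sum {ι : Type*} (s : Finset ι) (e : ι → ℕ → ℕ → B) :
    ∑ i ∈ s, biSeries (e i) = biSeries fun a b => ∑ i ∈ s, e i a b := by
  ext b a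
  simp only [map_sum, coeff_coeff_biSeries]

theorem biSeries_inj {e g : ℕ → ℕ → B} : biSeries e = biSeries g ↔ ∀ a b, e a b = g a b := by
  constructor
  · intro h a b
    rw [← coeff_coeff_biSeries e, h, coeff_coeff_biSeries]
  · intro h
    congr 1
    ext a b
    exact h a b

theorem C_X_comm (z : PowerSeries (PowerSeries B)) : C X * z = z * C X := by
  ext1 n
  simp only [coeff_C_mul, coeff_mul_C]
  exact PowerSeries.X_mul

theorem X_sub_C_X_comm (z : PowerSeries (PowerSeries B)) :
    (X - C X) * z = z * (X - C X) := by
  rw [sub_mul, mul_sub, C_X_comm, PowerSeries.X_mul]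

theorem C_X_mul_X_comm (z : PowerSeries (PowerSeries B)) :
    (C X * X) * z = z * (C X * X) := by
  rw [mul_assoc, PowerSeries.X_mul, ← mul_assoc, C_X_comm, mul_assoc]

/-- Coefficients of the equation `(y - x) e = x y g`, i.e. `(x⁻¹ - y⁻¹) e = g`. -/
theorem biSeries_eq_iff (e g : ℕ → ℕ → B) :
    (X - C X) * biSeries e = C X * X * biSeries g ↔
      (∀ b, e 0 b = 0) ∧ (∀ a, e a 0 = 0) ∧ ∀ a b, e (a + 1) b - e a (b + 1) = g a b := by
  have key : ∀ b a, coeff a (coeff b ((X - C X) * biSeries e))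
      = (if b = 0 then 0 else e a (b - 1)) - (if a = 0 then 0 else e (a - 1) b) := by
    intro b a
    rcases b with _ | b <;> rcases a with _ | a <;>
      simp [sub_mul, coeff_C_mul, coeff_succ_X_mul, biSeries]
  have key' : ∀ b a, coeff a (coeff b (C X * X * biSeries g))
      = if a = 0 ∨ b = 0 then 0 else g (a - 1) (b - 1) := by
    intro b a
    rcases b with _ | b <;> rcases a with _ | a <;>
      simp [mul_assoc, coeff_C_mul, coeff_succ_X_mul, biSeries]
  constructor
  · intro h
    have h' := fun a b => congrArg (fun z => coeff a (coeff b z)) h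
    simp only [key, key'] at h'
    refine ⟨fun b => ?_, fun a => ?_, fun a b => ?_⟩
    · simpa using h' 0 (b + 1)
    · simpa using h' (a + 1) 0
    · simpa using h' (a + 1) (b + 1)
  · rintro ⟨h1, h2, h3⟩
    ext b a
    rw [key, key']
    rcases b with _ | b <;> rcases a with _ | a <;> simp [h1, h2, h3]

end Series

/-! ### Matrices satisfying the RTT relations and their products. -/

section RTT

variable {n : ℕ} {B : Type*} [Ring B]

/-- A matrix of formal series satisfying the defining relations of the Yangian. -/
structure IsRTT (t : Fin n → Fin n → ℕ → B) : Prop where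
  zero : ∀ i j, t i j 0 = if i = j then 1 else 0
  rel : ∀ (i j h k : Fin n) (r s : ℕ),
    (t i j (r + 1) * t h k s - t h k s * t i j (r + 1))
        - (t i j r * t h k (s + 1) - t h k (s + 1) * t i j r)
      = t h j r * t i k s - t h j s * t i k r

theorem IsRTT.series {t : Fin n → Fin n → ℕ → B} (ht : IsRTT t) (i j h k : Fin n) :
    (PowerSeries.X - PowerSeries.C PowerSeries.X)
        * (serX (t i j) * serY (t h k) - serY (t h k) * serX (t i j))
      = PowerSeries.C PowerSeries.X * PowerSeries.X
        * (serX (t h j) * serY (t i k) - serY (t h j) * serX (t i k)) := by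
  simp only [serX_mul_serY, serY_mul_serX, biSeries_sub]
  rw [biSeries_eq_iff]
  refine ⟨fun b => ?_, fun a => ?_, fun a b => ht.rel i j h k a b⟩ <;> rw [ht.zero] <;>
    split_ifs <;> simp

theorem isRTT_of_series {t : Fin n → Fin n → ℕ → B} (h0 : ∀ i j, t i j 0 = if i = j then 1 else 0)
    (h : ∀ i j h k, (PowerSeries.X - PowerSeries.C PowerSeries.X)
        * (serX (t i j) * serY (t h k) - serY (t h k) * serX (t i j))
      = PowerSeries.C PowerSeries.X * PowerSeries.X
        * (serX (t h j) * serY (t i k) - serY (t h j) * serX (t i k))) : IsRTT t := by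
  refine ⟨h0, fun i j h' k r s => ?_⟩
  have := h i j h' k
  simp only [serX_mul_serY, serY_mul_serX, biSeries_sub] at this
  exact ((biSeries_eq_iff _ _).1 this).2.2 r s

/-- The computation behind the comultiplication of the Yangian. Expanding the commutator of products
by the two RTT relations gives the wanted right side plus cross terms that are antisymmetric in the
summation indices `l`, `p`. -/
theorem rtt_mul_aux {R : Type*} [Ring R] (α β : R) (hα : ∀ z, α * z = z * α)
    (hβ : ∀ z, β * z = z * β) (a b a' b' : Fin n → Fin n → R)
    (ha : ∀ i j h k, α * (a i j * a' h k - a' h k * a i j) = β * (a h j * a' i k - a' h j * a i k))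
    (hb : ∀ i j h k, α * (b i j * b' h k - b' h k * b i j) = β * (b h j * b' i k - b' h j * b i k))
    (hba : ∀ i j h k, b i j * a' h k = a' h k * b i j)
    (hab : ∀ i j h k, b' h k * a i j = a i j * b' h k) (i j h k : Fin n) :
    α * ((∑ l, a i l * b l j) * (∑ p, a' h p * b' p k)
        - (∑ p, a' h p * b' p k) * (∑ l, a i l * b l j))
      = β * ((∑ l, a h l * b l j) * (∑ p, a' i p * b' p k)
        - (∑ p, a' h p * b' p j) * (∑ l, a i l * b l k)) := by
  have e1 : ∀ l p i j h k, a i l * b l j * (a' h p * b' p k) = a i l * a' h p * (b l j * b' p k) := by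
    intro l p i j h k
    rw [mul_assoc, ← mul_assoc (b l j), hba]
    simp only [mul_assoc]
  have e2 : ∀ l p i j h k, a' h p * b' p k * (a i l * b l j) = a' h p * a i l * (b' p k * b l j) := by
    intro l p i j h k
    rw [mul_assoc, ← mul_assoc (b' p k), hab]
    simp only [mul_assoc]
  rw [Finset.sum_mul_sum, Finset.sum_mul_sum, Finset.sum_mul_sum, Finset.sum_mul_sum]
  simp only [e1, e2]
  rw [Finset.sum_comm (f := fun p l => a' h p * a i l * (b' p k * b l j)),
    Finset.sum_comm (f := fun p l => a' h p * a i l * (b' p j * b l k))]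
  have e3 : ∀ l p, α * (a i l * a' h p * (b l j * b' p k) - a' h p * a i l * (b' p k * b l j))
      = β * (a h l * a' i p * (b l j * b' p k) - a' h p * a i l * (b' p j * b l k))
        + (β * (a' h p * a i l * (b p j * b' l k)) - β * (a' h l * a i p * (b l j * b' p k))) := by
    intro l p
    have h1 : α * (a i l * a' h p * (b l j * b' p k) - a' h p * a i l * (b' p k * b l j))
        = α * (a i l * a' h p - a' h p * a i l) * (b l j * b' p k)
          + a' h p * a i l * (α * (b l j * b' p k - b' p k * b l j)) := by
      rw [← mul_assoc (a' h p * a i l) α, ← hα (a' h p * a i l)]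
      noncomm_ring
    rw [h1, ha, hb, ← mul_assoc (a' h p * a i l) β, ← hβ (a' h p * a i l)]
    noncomm_ring
  simp only [← Finset.sum_sub_distrib, Finset.mul_sum]
  simp only [e3, Finset.sum_add_distrib, Finset.sum_sub_distrib]
  -- The cross terms cancel after exchanging `l` and `p`.
  rw [Finset.sum_comm (f := fun l p => β * (a' h p * a i l * (b p j * b' l k))), sub_self, add_zero]

/-- The product of two matrices of formal series. -/
def convMul (t t' : Fin n → Fin n → ℕ → B) : Fin n → Fin n → ℕ → B :=
  fun i j r => ∑ p ∈ Finset.HasAntidiagonal.antidiagonal r, ∑ l, t i l p.1 * t' l j p.2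

theorem serX_convMul (t t' : Fin n → Fin n → ℕ → B) (i j : Fin n) :
    serX (convMul t t' i j) = ∑ l, serX (t i l) * serX (t' l j) := by
  simp only [serX, ← map_mul, ← map_sum]
  congr 1
  ext r
  simp only [PowerSeries.coeff_mk, map_sum, PowerSeries.coeff_mul, convMul]
  rw [Finset.sum_comm]

theorem serY_convMul (t t' : Fin n → Fin n → ℕ → B) (i j : Fin n) :
    serY (convMul t t' i j) = ∑ l, serY (t i l) * serY (t' l j) := by
  ext1 r
  simp only [serY, PowerSeries.coeff_mk, map_sum, PowerSeries.coeff_mul, convMul, map_mul]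
  rw [Finset.sum_comm]

theorem convMul_zero {t t' : Fin n → Fin n → ℕ → B}
    (h : ∀ i j, t i j 0 = if i = j then 1 else 0) (h' : ∀ i j, t' i j 0 = if i = j then 1 else 0)
    (i j : Fin n) : convMul t t' i j 0 = if i = j then 1 else 0 := by
  simp [convMul, h, h']

theorem IsRTT.mul {t t' : Fin n → Fin n → ℕ → B} (ht : IsRTT t) (ht' : IsRTT t')
    (hc : ∀ i j r h k s, t i j r * t' h k s = t' h k s * t i j r) : IsRTT (convMul t t') := by
  refine isRTT_of_series (convMul_zero ht.zero ht'.zero) fun i j h k => ?_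
  simp only [serX_convMul, serY_convMul]
  refine rtt_mul_aux _ _ X_sub_C_X_comm C_X_mul_X_comm _ _ _ _ ht.series ht'.series ?_ ?_ i j h k
  · intro i j h k
    rw [serX_mul_serY, serY_mul_serX]
    exact biSeries_inj.2 fun a b => (hc _ _ _ _ _ _).symm
  · intro i j h k
    rw [serX_mul_serY, serY_mul_serX]
    exact biSeries_inj.2 fun a b => (hc _ _ _ _ _ _).symm

end RTT

/-! ### Oscillator representations and their leading terms. -/

section

open MvPolynomial

section Oscillator

variable {n : ℕ} {κ : Type*}

/-- The variables `x_i^{(k)}`, `p_i^{(k)}`, `a_k` of the oscillator module. -/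
abbrev OscVar (n : ℕ) (κ : Type*) : Type _ := κ × (Fin n ⊕ Fin n ⊕ Unit)

/-- The space of polynomials in the variables `x_i^{(k)}`, `p_i^{(k)}`, `a_k`. -/
abbrev Osc (n : ℕ) (κ : Type*) : Type _ := MvPolynomial (OscVar n κ) ℂ

/-- The variable `x_i^{(k)}`. -/
def xv (k : κ) (i : Fin n) : OscVar n κ := (k, Sum.inl i)

/-- The variable `p_i^{(k)}`. -/
def pv (k : κ) (i : Fin n) : OscVar n κ := (k, Sum.inr (Sum.inl i))

/-- The variable `a_k`. -/
def av (n : ℕ) (k : κ) : OscVar n κ := (k, Sum.inr (Sum.inr ()))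

theorem pderiv_comm {σ R : Type*} [CommRing R] (i j : σ) (f : MvPolynomial σ R) :
    pderiv i (pderiv j f) = pderiv j (pderiv i f) := by
  classical
  have h : ⁅pderiv (R := R) i, pderiv (R := R) j⁆ = 0 := by
    refine derivation_ext fun k => ?_
    rw [Derivation.commutator_apply, pderiv_X, pderiv_X, Pi.single_apply, Pi.single_apply]
    split_ifs <;> simp
  have := congrArg (fun D => D f) h
  simpa [Derivation.commutator_apply, sub_eq_zero] using this

/-- The action `x_i (p_j + ∂/∂x_j)` of the matrix unit `e_{i,j}` on the `k`-th oscillator. -/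
def oscE (k : κ) (i j : Fin n) : Module.End ℂ (Osc n κ) :=
  (LinearMap.mulLeft ℂ (X (xv k i))).comp
    (LinearMap.mulLeft ℂ (X (pv k j)) + (pderiv (R := ℂ) (xv k j)).toLinearMap)

theorem oscE_apply (k : κ) (i j : Fin n) (f : Osc n κ) :
    oscE k i j f = X (xv k i) * (X (pv k j) * f + pderiv (xv k j) f) := rfl

theorem pderiv_xv_pv (k k' : κ) (i j : Fin n) :
    pderiv (xv k i) (X (pv k' j) : Osc n κ) = 0 :=
  pderiv_X_of_ne (by simp [xv, pv])

theorem pderiv_xv_av (k k' : κ) (i : Fin n) :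
    pderiv (xv k i) (X (av n k') : Osc n κ) = 0 :=
  pderiv_X_of_ne (by simp [xv, av])

theorem pderiv_xv_xv (k : κ) (i j : Fin n) :
    pderiv (xv k i) (X (xv k j) : Osc n κ) = if j = i then 1 else 0 := by
  split_ifs with h
  · subst h; exact pderiv_X_self _
  · exact pderiv_X_of_ne (by simpa [xv] using h)

theorem pderiv_xv_xv_of_ne {k k' : κ} (hk : k ≠ k') (i j : Fin n) :
    pderiv (xv k i) (X (xv k' j) : Osc n κ) = 0 :=
  pderiv_X_of_ne (by simp [xv, hk.symm])

/-- The operator `p_j + ∂/∂x_j` is `∂/∂x_j` conjugated by the exponential of `∑ x_i p_i`, so the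
relations of `𝔤𝔩_n` persist. The twist makes the value at `1` equal to `x_i p_j` instead of `0`. -/
theorem oscE_comm (k : κ) (i j h l : Fin n) :
    oscE k i j * oscE k h l - oscE k h l * oscE k i j
      = (if h = j then oscE k i l else 0) - (if i = l then oscE k h j else 0) := by
  refine LinearMap.ext fun f => ?_
  have e1 : (if h = j then oscE k i l else 0 : Module.End ℂ (Osc n κ)) f
      = (if h = j then 1 else 0) * oscE k i l f := by split_ifs <;> simp
  have e2 : (if i = l then oscE k h j else 0 : Module.End ℂ (Osc n κ)) f
      = (if i = l then 1 else 0) * oscE k h j f := by split_ifs <;> simp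
  rw [LinearMap.sub_apply, LinearMap.sub_apply, e1, e2]
  simp only [Module.End.mul_apply, oscE_apply, Derivation.leibniz, map_add, smul_eq_mul,
    pderiv_xv_pv, pderiv_xv_xv, pderiv_comm (xv k l) (xv k j)]
  ring

theorem oscE_comm_of_ne {k k' : κ} (hk : k ≠ k') (i j h l : Fin n) :
    oscE k i j * oscE k' h l = oscE k' h l * oscE k i j := by
  refine LinearMap.ext fun f => ?_
  simp only [Module.End.mul_apply, oscE_apply, Derivation.leibniz, map_add, smul_eq_mul,
    pderiv_xv_pv, pderiv_xv_xv_of_ne hk, pderiv_xv_xv_of_ne hk.symm,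
    pderiv_comm (xv k' l) (xv k j)]
  ring

/-- Multiplication by `a_k^r`. -/
def oscA (n : ℕ) (k : κ) (r : ℕ) : Module.End ℂ (Osc n κ) := LinearMap.mulLeft ℂ (X (av n k) ^ r)

theorem oscA_mul (k : κ) (r s : ℕ) : oscA n k r * oscA n k s = oscA n k (r + s) := by
  refine LinearMap.ext fun f => ?_
  simp only [oscA, Module.End.mul_apply, LinearMap.mulLeft_apply]
  ring

theorem oscA_comm (k k' : κ) (r s : ℕ) : oscA n k r * oscA n k' s = oscA n k' s * oscA n k r := by
  refine LinearMap.ext fun f => ?_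
  simp only [oscA, Module.End.mul_apply, LinearMap.mulLeft_apply]
  ring

theorem oscE_oscA_comm (k k' : κ) (i j : Fin n) (r : ℕ) :
    oscE k i j * oscA n k' r = oscA n k' r * oscE k i j := by
  refine LinearMap.ext fun f => ?_
  simp only [oscA, Module.End.mul_apply, LinearMap.mulLeft_apply, oscE_apply, Derivation.leibniz,
    Derivation.leibniz_pow, pderiv_xv_av, smul_eq_mul]
  ring

/-- The evaluation representation `1 + ∑ a_k^r e_{i,j} u^{-r-1}` on the `k`-th oscillator. -/
def oscL (k : κ) (i j : Fin n) : ℕ → Module.End ℂ (Osc n κ)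
  | 0 => if i = j then 1 else 0
  | r + 1 => oscA n k r * oscE k i j

/-- For positive upper indices every product depends on them only through the power of `a_k`, hence
through their sum, so both sides vanish. The cases with an index `0` are the relations of `𝔤𝔩_n`. -/
theorem oscL_isRTT (k : κ) : IsRTT (oscL (n := n) k) := by
  have c : ∀ i j h l r s, oscL (n := n) k i j (r + 1) * oscL k h l (s + 1)
      = oscA n k (r + s) * (oscE k i j * oscE k h l) := by
    intro i j h l r s
    simp only [oscL]
    rw [mul_assoc, ← mul_assoc (oscE k i j), oscE_oscA_comm, ← oscA_mul]
    simp only [mul_assoc]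
  have A0 : oscA n k 0 = 1 := LinearMap.ext fun f => by simp [oscA]
  refine ⟨fun i j => rfl, fun i j h l r s => ?_⟩
  rcases r with _ | r <;> rcases s with _ | s
  · simp only [oscL]; split_ifs <;> simp
  · rw [c i j h l 0 s, c h l i j s 0, add_comm s 0, ← mul_sub, oscE_comm]
    rw [mul_sub]
    simp only [oscL]
    split_ifs <;> simp
  · rw [c i j h l r 0, c h l i j 0 r, add_comm 0 r, ← mul_sub, oscE_comm]
    rw [mul_sub]
    simp only [oscL]
    split_ifs <;> simp
  · rw [c, c, c, c, c, c, show s + (r + 1) = r + 1 + s by ring,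
      show s + 1 + r = r + 1 + s by ring, show r + (s + 1) = r + 1 + s by ring, sub_self,
      add_comm s r, ← mul_sub]
    simp

/-- The degrees of the variables of the oscillator module. -/
def oscWt : OscVar n κ → ℕ
  | (_, Sum.inl _) => 0
  | (_, Sum.inr (Sum.inl _)) => 1
  | (_, Sum.inr (Sum.inr _)) => 2

/-- The polynomials of degree less than `d`. -/
def OFlt (n : ℕ) (κ : Type*) (d : ℕ) : Submodule ℂ (Osc n κ) :=
  Submodule.span ℂ {f | ∃ s, Finsupp.weight oscWt s < d ∧ monomial s 1 = f}

theorem monomial_mem_OFlt {s : OscVar n κ →₀ ℕ} {d : ℕ} (h : Finsupp.weight oscWt s < d) (c : ℂ) :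
    monomial s c ∈ OFlt n κ d := by
  have : monomial s 1 ∈ OFlt n κ d := Submodule.subset_span ⟨s, h, rfl⟩
  have h2 := Submodule.smul_mem _ c this
  rwa [smul_monomial, smul_eq_mul, mul_one] at h2

theorem OFlt_induction {d : ℕ} (S : Submodule ℂ (Osc n κ))
    (h : ∀ s, Finsupp.weight oscWt s < d → monomial s 1 ∈ S) : OFlt n κ d ≤ S := by
  rw [OFlt, Submodule.span_le]
  rintro _ ⟨s, hs, rfl⟩
  exact h s hs

theorem OFlt_mono {d e : ℕ} (h : d ≤ e) : OFlt n κ d ≤ OFlt n κ e :=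
  OFlt_induction _ fun _ hs => monomial_mem_OFlt (hs.trans_le h) 1

theorem mul_mem_OFlt {p q r : ℕ} {f g : Osc n κ} (hf : f ∈ OFlt n κ p) (hg : g ∈ OFlt n κ q)
    (h : p + q ≤ r + 1) : f * g ∈ OFlt n κ r := by
  refine (OFlt_induction ((OFlt n κ r).comap (LinearMap.mulRight ℂ g)) fun s hs => ?_) hf
  refine (OFlt_induction ((OFlt n κ r).comap (LinearMap.mulLeft ℂ (monomial s 1)))
    fun t ht => ?_) hg
  simp only [Submodule.mem_comap, LinearMap.mulLeft_apply, monomial_mul]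
  exact monomial_mem_OFlt (by rw [map_add]; omega) _

theorem X_mem_OFlt {v : OscVar n κ} {d : ℕ} (h : oscWt v < d) : X v ∈ OFlt n κ d :=
  monomial_mem_OFlt (by simpa [Finsupp.weight_single] using h) 1

theorem one_mem_OFlt {d : ℕ} (h : 0 < d) : (1 : Osc n κ) ∈ OFlt n κ d :=
  monomial_mem_OFlt (s := 0) (by simpa using h) 1

theorem X_pow_mem_OFlt (k : κ) (r : ℕ) : X (av n k) ^ r ∈ OFlt n κ (2 * r + 1) := by
  induction r with
  | zero => simpa using one_mem_OFlt one_pos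
  | succ r ih =>
    rw [pow_succ]
    exact mul_mem_OFlt ih (X_mem_OFlt (d := 3) (by simp [oscWt, av])) (by omega)

theorem pderiv_mem_OFlt (v : OscVar n κ) {d : ℕ} {f : Osc n κ} (hf : f ∈ OFlt n κ d) :
    pderiv v f ∈ OFlt n κ d := by
  refine (OFlt_induction ((OFlt n κ d).comap (pderiv (R := ℂ) v).toLinearMap) fun s hs => ?_) hf
  change pderiv v (monomial s 1) ∈ OFlt n κ d
  rw [pderiv_monomial]
  refine monomial_mem_OFlt (lt_of_le_of_lt ?_ hs) _
  conv_rhs => rw [← add_tsub_cancel_of_le (tsub_le_self : s - Finsupp.single v 1 ≤ s), map_add]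
  exact Nat.le_add_right _ _

theorem coeff_eq_zero_of_mem_OFlt {d : ℕ} {f : Osc n κ} (hf : f ∈ OFlt n κ d)
    {s : OscVar n κ →₀ ℕ} (hs : d ≤ Finsupp.weight oscWt s) : coeff s f = 0 := by
  classical
  refine (OFlt_induction (LinearMap.ker (lcoeff ℂ s)) fun t ht => ?_) hf
  rw [LinearMap.mem_ker, lcoeff_apply, coeff_monomial, if_neg]
  rintro rfl
  omega

/-- The operators `A_r` of degree `2r - 1` have the polynomials `q_{r-1}` as their symbols. -/
def HasLead (A : ℕ → Module.End ℂ (Osc n κ)) (q : ℕ → Osc n κ) : Prop :=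
  ∀ r, q r ∈ OFlt n κ (2 * r + 2) ∧
    ∀ d, ∀ f ∈ OFlt n κ d, A (r + 1) f - q r * f ∈ OFlt n κ (d + 2 * r)

theorem HasLead.mem {A : ℕ → Module.End ℂ (Osc n κ)} {q : ℕ → Osc n κ} (h : HasLead A q) (r : ℕ)
    {d : ℕ} {f : Osc n κ} (hf : f ∈ OFlt n κ d) : A (r + 1) f ∈ OFlt n κ (d + 2 * r + 1) := by
  have := add_mem (OFlt_mono (Nat.le_succ _) ((h r).2 d f hf))
    (mul_mem_OFlt (r := d + 2 * r + 1) (h r).1 hf (by omega))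
  simpa using this

/-- With `x`, `p`, `a` of degrees `0`, `1`, `2`, the term with `∂/∂x_j` has one degree less than the
multiplication by `p_j`. -/
theorem oscL_hasLead (k : κ) (i j : Fin n) :
    HasLead (oscL k i j) fun r => X (av n k) ^ r * (X (xv k i) * X (pv k j)) := by
  intro r
  have hx : X (xv k i) ∈ OFlt n κ 1 := X_mem_OFlt (by simp [oscWt, xv])
  have hp : X (pv k j) ∈ OFlt n κ 2 := X_mem_OFlt (by simp [oscWt, pv])
  refine ⟨mul_mem_OFlt (X_pow_mem_OFlt k r) (mul_mem_OFlt (r := 2) hx hp le_rfl) (by omega), ?_⟩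
  intro d f hf
  have : oscL k i j (r + 1) f - X (av n k) ^ r * (X (xv k i) * X (pv k j)) * f
      = X (av n k) ^ r * (X (xv k i) * pderiv (xv k j) f) := by
    simp only [oscL, Module.End.mul_apply, oscA, LinearMap.mulLeft_apply, oscE_apply]
    ring
  rw [this]
  exact mul_mem_OFlt (X_pow_mem_OFlt k r)
    (mul_mem_OFlt (r := d) hx (pderiv_mem_OFlt _ hf) (by omega)) (by omega)

/-- Leading terms add: the two extreme summands of the convolution survive, while a product of two
factors of positive index has degree at most `2r`, one less than the leading degree. -/
theorem HasLead.convMul {t t' : Fin n → Fin n → ℕ → Module.End ℂ (Osc n κ)}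
    {q q' : Fin n → Fin n → ℕ → Osc n κ} (h0 : ∀ i j, t i j 0 = if i = j then 1 else 0)
    (h0' : ∀ i j, t' i j 0 = if i = j then 1 else 0) (h : ∀ i j, HasLead (t i j) (q i j))
    (h' : ∀ i j, HasLead (t' i j) (q' i j)) (i j : Fin n) :
    HasLead (convMul t t' i j) fun r => q' i j r + q i j r := by
  have mid : ∀ l a b d, ∀ f ∈ OFlt n κ d,
      (t i l (a + 1) * t' l j (b + 1)) f ∈ OFlt n κ (d + 2 * (a + b + 1)) := by
    intro l a b d f hf
    rw [Module.End.mul_apply]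
    exact OFlt_mono (by omega) ((h i l).mem a ((h' l j).mem b hf))
  intro r
  refine ⟨add_mem (h' i j r).1 (h i j r).1, fun d f hf => ?_⟩
  have key : Yangian.convMul t t' i j (r + 1) f - (t' i j (r + 1) f + t i j (r + 1) f)
      ∈ OFlt n κ (d + 2 * r) := by
    rcases r with _ | r
    · rw [Yangian.convMul, Finset.Nat.sum_antidiagonal_succ]
      simp [h0, h0']
    · rw [Yangian.convMul, Finset.Nat.sum_antidiagonal_succ, Finset.Nat.sum_antidiagonal_succ']
      have e1 : ∑ l, t i l 0 * t' l j (r + 1 + 1) = t' i j (r + 1 + 1) := by simp [h0]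
      have e2 : ∑ l, t i l (r + 1 + 1) * t' l j 0 = t i j (r + 1 + 1) := by simp [h0']
      simp only [e1, e2, LinearMap.add_apply, LinearMap.sum_apply]
      rw [add_sub_add_left_eq_sub, add_sub_cancel_left]
      refine sum_mem fun p hp => sum_mem fun l _ => ?_
      rw [Finset.HasAntidiagonal.mem_antidiagonal] at hp
      rw [← hp]
      exact mid l p.1 p.2 d f hf
  have := add_mem key (add_mem ((h' i j r).2 d f hf) ((h i j r).2 d f hf))
  convert this using 1
  ring

/-- The tensor product of the evaluation representations for a list of oscillators. -/
def oscT : List κ → Fin n → Fin n → ℕ → Module.End ℂ (Osc n κ)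
  | [] => fun i j r => if r = 0 then if i = j then 1 else 0 else 0
  | k :: l => convMul (oscT l) (oscL k)

theorem oscL_comm {k k' : κ} (hk : k ≠ k') (i j h l : Fin n) (r s : ℕ) :
    oscL k i j r * oscL k' h l s = oscL k' h l s * oscL k i j r := by
  rcases r with _ | r
  · simp only [oscL]; split_ifs <;> simp
  rcases s with _ | s
  · simp only [oscL]; split_ifs <;> simp
  simp only [oscL]
  have c1 : Commute (oscA n k r) (oscA n k' s) := oscA_comm _ _ _ _
  have c2 : Commute (oscE k i j) (oscA n k' s) := oscE_oscA_comm _ _ _ _ _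
  have c3 : Commute (oscA n k r) (oscE k' h l) := (oscE_oscA_comm _ _ _ _ _).symm
  have c4 : Commute (oscE k i j) (oscE k' h l) := oscE_comm_of_ne hk _ _ _ _
  exact ((c1.mul_left c2).mul_right (c3.mul_left c4)).eq

theorem oscT_comm (l : List κ) {k : κ} (hk : k ∉ l) (i j : Fin n) (r : ℕ) (h h' : Fin n) (s : ℕ) :
    Commute (oscT l i j r) (oscL k h h' s) := by
  induction l generalizing i j r with
  | nil =>
    simp only [oscT]
    split_ifs
    · exact Commute.one_left _
    · exact Commute.zero_left _
    · exact Commute.zero_left _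
  | cons k' l ih =>
    simp only [List.mem_cons, not_or] at hk
    refine Commute.sum_left _ _ _ fun p _ => Commute.sum_left _ _ _ fun m _ => ?_
    exact (ih hk.2 _ _ _).mul_left (oscL_comm (Ne.symm hk.1) _ _ _ _ _ _)

theorem oscT_isRTT {l : List κ} (hl : l.Nodup) : IsRTT (oscT (n := n) l) := by
  induction l with
  | nil =>
    refine ⟨fun i j => by simp [oscT], fun i j h k r s => ?_⟩
    rcases r with _ | r <;> rcases s with _ | s <;> simp [oscT]
  | cons k l ih =>
    rw [List.nodup_cons] at hl
    exact (ih hl.2).mul (oscL_isRTT k) fun i j r h h' s => oscT_comm l hl.1 i j r h h' s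

/-- The symbol of `T_{i,j}^{(r+1)}` in the oscillator representation. -/
def oscSymbol (l : List κ) (v : Idx n) : Osc n κ :=
  (l.map fun k => X (av n k) ^ v.2.2 * (X (xv k v.1) * X (pv k v.2.1))).sum

theorem oscT_hasLead {l : List κ} (hl : l.Nodup) (i j : Fin n) :
    HasLead (oscT l i j) fun r => oscSymbol l (i, j, r) := by
  induction l generalizing i j with
  | nil =>
    intro r
    refine ⟨zero_mem _, fun d f _ => ?_⟩
    simp [oscT, oscSymbol]
  | cons k l ih =>
    rw [List.nodup_cons] at hl
    have := HasLead.convMul (oscT_isRTT hl.2).zero (oscL_isRTT k).zero (ih hl.2) (oscL_hasLead k) i j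
    exact this

/-- The oscillator representation of the Yangian. -/
def oscRep {l : List κ} (hl : l.Nodup) : Yangian n →ₐ[ℂ] Module.End ℂ (Osc n κ) :=
  lift (oscT l) (oscT_isRTT hl).zero (oscT_isRTT hl).rel

theorem oscRep_gen {l : List κ} (hl : l.Nodup) (v : Idx n) :
    oscRep hl (gen v) = oscT l v.1 v.2.1 (v.2.2 + 1) := lift_T _ _ _ _ _ _

theorem oscRep_word {l : List κ} (hl : l.Nodup) (w : List (Idx n)) :
    oscRep hl (word w) 1 - aeval (oscSymbol l) (mon w) ∈ OFlt n κ (wtl w) ∧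
      aeval (oscSymbol l) (mon w) ∈ OFlt n κ (wtl w + 1) := by
  induction w with
  | nil => simpa using one_mem_OFlt one_pos
  | cons v w ih =>
    have hv := oscT_hasLead hl v.1 v.2.1 v.2.2
    have h1 : oscRep hl (word w) 1 ∈ OFlt n κ (wtl w + 1) := by
      have := add_mem (OFlt_mono (Nat.le_succ _) ih.1) ih.2
      simpa using this
    have h2 := hv.2 _ _ h1
    have h3 := mul_mem_OFlt (r := wtl (v :: w)) hv.1 ih.1 (by simp only [wtl_cons, wt]; omega)
    refine ⟨?_, ?_⟩
    · have h4 := add_mem (OFlt_mono (show wtl w + 1 + 2 * v.2.2 ≤ wtl (v :: w) by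
        simp only [wtl_cons, wt]; omega) h2) h3
      convert h4 using 1
      rw [word_cons, map_mul, Module.End.mul_apply, oscRep_gen, mon_cons, map_mul, aeval_X]
      ring
    · rw [mon_cons, map_mul, aeval_X]
      exact mul_mem_OFlt hv.1 ih.2 (by simp only [wtl_cons, wt]; omega)

theorem oscRep_mem_of_mem_Sym {l : List κ} (hl : l.Nodup) {d : ℕ} {x : Yangian n} {P}
    (hx : (x, P) ∈ Sym n d) : oscRep hl x 1 - aeval (oscSymbol l) P ∈ OFlt n κ d := by
  refine (Sym_induction ((OFlt n κ d).comap
    (((LinearMap.applyₗ (R := ℂ) (1 : Osc n κ)).comp (oscRep hl).toLinearMap).comp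
      (LinearMap.fst ℂ _ _)
    - (aeval (R := ℂ) (oscSymbol l)).toLinearMap.comp (LinearMap.snd ℂ _ _))) ?_ ?_) hx
  · rintro w rfl
    exact (oscRep_word hl w).1
  · intro w hw
    have := add_mem (OFlt_mono (Nat.le_succ _) (oscRep_word hl w).1) (oscRep_word hl w).2
    rw [sub_add_cancel] at this
    simpa using OFlt_mono hw this

theorem oscSymbol_isWeightedHomogeneous (l : List κ) (v : Idx n) :
    IsWeightedHomogeneous oscWt (oscSymbol l v) (wt v) := by
  induction l with
  | nil => exact isWeightedHomogeneous_zero ℂ _ _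
  | cons k l ih =>
    refine IsWeightedHomogeneous.add ?_ ih
    have h1 := ((isWeightedHomogeneous_X ℂ oscWt (av n k)).pow v.2.2).mul
      ((isWeightedHomogeneous_X ℂ oscWt (xv k v.1)).mul
        (isWeightedHomogeneous_X ℂ oscWt (pv k v.2.1)))
    convert h1 using 1
    simp [wt, oscWt, av, xv, pv, mul_comm]

theorem aeval_oscSymbol_mon_isWeightedHomogeneous (l : List κ) (w : List (Idx n)) :
    IsWeightedHomogeneous oscWt (aeval (oscSymbol l) (mon w)) (wtl w) := by
  induction w with
  | nil =>
    rw [mon_nil, map_one]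
    exact isWeightedHomogeneous_one ℂ _
  | cons v w ih =>
    rw [mon_cons, map_mul, aeval_X, wtl_cons]
    exact (oscSymbol_isWeightedHomogeneous l v).mul ih

theorem aeval_oscSymbol_isWeightedHomogeneous (l : List κ) {d : ℕ} {x : Yangian n} {P}
    (hx : (x, P) ∈ Sym n d) : IsWeightedHomogeneous oscWt (aeval (oscSymbol l) P) d := by
  rw [Sym] at hx
  generalize hy : (x, P) = y at hx
  have hP : P = y.2 := by rw [← hy]
  rw [hP]
  clear hP hy
  induction hx using Submodule.span_induction with
  | mem y hy =>
    rcases hy with ⟨w, hw, rfl⟩ | ⟨w, hw, rfl⟩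
    · rw [← hw]
      exact aeval_oscSymbol_mon_isWeightedHomogeneous l w
    · rw [map_zero]
      exact isWeightedHomogeneous_zero ℂ _ _
  | zero =>
    rw [Prod.snd_zero, map_zero]
    exact isWeightedHomogeneous_zero ℂ _ _
  | add y z _ _ hy hz =>
    rw [Prod.snd_add, map_add]
    exact hy.add hz
  | smul c y _ hy =>
    rw [Prod.smul_snd, map_smul]
    exact Submodule.smul_mem (weightedHomogeneousSubmodule ℂ oscWt d) c hy

/-- The part of degree `d` of the action of `x` on the vector `1` is the substituted symbol. For `x
= 0` that polynomial is homogeneous of degree `d` and also of degree less than `d`. -/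
theorem aeval_oscSymbol_eq_zero {l : List κ} (hl : l.Nodup) {d : ℕ} {P}
    (hx : ((0 : Yangian n), P) ∈ Sym n d) : aeval (oscSymbol l) P = 0 := by
  have h1 := oscRep_mem_of_mem_Sym hl hx
  simp only [map_zero, LinearMap.zero_apply, zero_sub, neg_mem_iff] at h1
  ext s
  rw [coeff_zero]
  by_contra h
  exact h (coeff_eq_zero_of_mem_OFlt h1 (aeval_oscSymbol_isWeightedHomogeneous l hx h).ge)

end Oscillator

/-! ### The Poincaré-Birkhoff-Witt theorem by Vandermonde interpolation. -/

theorem exists_sum_pow_mul_eq (R : ℕ) (b : ℕ → ℂ) :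
    ∃ c : Fin R → ℂ, ∀ r < R, ∑ s : Fin R, (s : ℂ) ^ r * c s = b r := by
  let V : Matrix (Fin R) (Fin R) ℂ := (Matrix.vandermonde fun s : Fin R => (s : ℂ)).transpose
  have hV : IsUnit V.det := by
    rw [Matrix.det_transpose, isUnit_iff_ne_zero, Matrix.det_vandermonde_ne_zero_iff]
    intro s t h
    exact Fin.ext (Nat.cast_injective h)
  let b' : Fin R → ℂ := fun r => b r
  have h : V.mulVec (V⁻¹.mulVec b') = b' := by
    rw [Matrix.mulVec_mulVec, Matrix.mul_nonsing_inv _ hV, Matrix.one_mulVec]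
  exact ⟨V⁻¹.mulVec b', fun r hr => congrFun h ⟨r, hr⟩⟩

/-- The symbol of an element is unique: this is the Poincaré-Birkhoff-Witt theorem. -/
theorem eq_zero_of_zero_mem_Sym {n d : ℕ} {P : MvPolynomial (Idx n) ℂ}
    (h : ((0 : Yangian n), P) ∈ Sym n d) : P = 0 := by
  classical
  refine MvPolynomial.funext fun b => ?_
  rw [map_zero]
  obtain ⟨R, hR⟩ : ∃ R, ∀ v ∈ P.vars, v.2.2 < R :=
    ⟨P.vars.sup (fun v => v.2.2) + 1, fun v hv =>
      Nat.lt_succ_of_le (Finset.le_sup (f := fun v : Idx n => v.2.2) hv)⟩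
  -- Weights at the nodes `0, …, R - 1` whose power sums interpolate the prescribed values `b (i, j,
  -- r)` for `r < R`.
  choose c hc using fun i j => exists_sum_pow_mul_eq R fun r => b (i, j, r)
  let l : List (Fin R × Fin n × Fin n) := Finset.univ.toList
  -- The oscillator `(s, i, j)` sits at `a = s`, with `x` supported at `i` and `p` at `j`. It
  -- contributes `s ^ r * c i j s` to the coordinate `(i, j, r)` only, so the substituted symbols
  -- take the values `b` on all variables of `P`.
  let pt : OscVar n (Fin R × Fin n × Fin n) → ℂ
    | (k, Sum.inl i) => if i = k.2.1 then c k.2.1 k.2.2 k.1 else 0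
    | (k, Sum.inr (Sum.inl j)) => if j = k.2.2 then 1 else 0
    | (k, Sum.inr (Sum.inr _)) => (k.1 : ℂ)
  have h0 := congrArg (eval pt) (aeval_oscSymbol_eq_zero (Finset.nodup_toList _ : l.Nodup) h)
  rw [map_zero] at h0
  rw [← h0]
  have e : eval pt (aeval (oscSymbol l) P) = ((eval pt).comp (aeval (oscSymbol l)).toRingHom) P :=
    rfl
  rw [e]
  refine hom_congr_vars ?_ ?_ rfl
  · ext r; simp
  · rintro ⟨i, j, r⟩ hv -
    have hr := hR _ hv
    rw [eval_X, RingHom.comp_apply]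
    change _ = eval pt (aeval (oscSymbol l) (X (i, j, r)))
    rw [aeval_X, oscSymbol, Finset.sum_map_toList, map_sum, Fintype.sum_prod_type]
    simp only [map_mul, map_pow, eval_X, Fintype.sum_prod_type, pt, av, xv, pv]
    simp [← hc i j r hr]

end

/-! ### The Poisson centralizer of the upper left block. -/

section

open MvPolynomial

theorem pderiv_X_eq_ite {σ : Type*} [DecidableEq σ] (v w : σ) :
    pderiv v (X w : MvPolynomial σ ℂ) = if w = v then 1 else 0 := by
  split_ifs with h
  · rw [h, pderiv_X_self]
  · exact pderiv_X_of_ne h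

theorem ite_derivation_apply {σ : Type*} (p : Prop) [Decidable p]
    (D : Derivation ℂ (MvPolynomial σ ℂ) (MvPolynomial σ ℂ)) (x : MvPolynomial σ ℂ) :
    (if p then D else 0) x = if p then D x else 0 := by
  split_ifs
  · rfl
  · rw [Derivation.coe_zero, Pi.zero_apply]

theorem pderiv_brk {N : ℕ} (a b i j : Fin N) (r s : ℕ) (v : Idx N) :
    pderiv (a, b, r + s) (brk i j r v)
      = (if a = i then pderiv (j, b, s) (X v) else 0)
        - (if b = j then pderiv (a, i, s) (X v) else 0) := by
  obtain ⟨h, k, t⟩ := v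
  rw [brk, map_sub, apply_ite (pderiv (a, b, r + s)), apply_ite (pderiv (a, b, r + s)), map_zero]
  simp only [pderiv_X_eq_ite, ← ite_and, Prod.mk.injEq, Nat.add_left_cancel_iff]
  congr 1
  · exact if_congr ⟨fun ⟨h1, h2, h3, h4⟩ => ⟨h2.symm, h1, h3, h4⟩,
      fun ⟨h1, h2, h3, h4⟩ => ⟨h2, h1.symm, h3, h4⟩⟩ rfl rfl
  · exact if_congr ⟨fun ⟨h1, h2, h3, h4⟩ => ⟨h3.symm, h2, h1.symm, h4⟩,
      fun ⟨h1, h2, h3, h4⟩ => ⟨h3.symm, h2, h1.symm, h4⟩⟩ rfl rfl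

/-- Both sides are derivations, so it suffices to compare them on coordinates. There the bracket is
linear, and it raises the degree in `t` from `s` to `r + s`. -/
theorem commutator_pderiv_poisson {N : ℕ} (a b i j : Fin N) (r s : ℕ) :
    ⁅pderiv (R := ℂ) (a, b, r + s), poisson i j r⁆
      = (if a = i then pderiv (j, b, s) else 0) - (if b = j then pderiv (a, i, s) else 0) := by
  refine derivation_ext fun v => ?_
  have e3 : poisson i j r (pderiv (a, b, r + s) (X v)) = 0 := by
    rw [pderiv_X_eq_ite, apply_ite (poisson i j r), Derivation.map_one_eq_zero, map_zero, ite_self]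
  rw [Derivation.commutator_apply, e3, sub_zero, Derivation.sub_apply, ite_derivation_apply,
    ite_derivation_apply, poisson, mkDerivation_X, pderiv_brk]

/-- A bracket with a coordinate of high degree in `t` is linear in fresh variables, whose
coefficients are partial derivatives. -/
theorem pderiv_eq_of_poisson_eq_zero {N : ℕ} {P : MvPolynomial (Idx N) ℂ} {i j : Fin N}
    (h : ∀ r, poisson i j r P = 0) (a b : Fin N) (s : ℕ) :
    (if a = i then pderiv (j, b, s) P else 0) = if b = j then pderiv (a, i, s) P else 0 := by
  classical
  -- For such `r` the derivative of `P` itself vanishes, so only the commutator with the bracket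
  -- remains.
  obtain ⟨r, hr⟩ : ∃ r, (a, b, r + s) ∉ P.vars := by
    by_contra! hc
    refine Set.infinite_of_injective_forall_mem (f := fun r : ℕ => ((a, b, r + s) : Idx N)) ?_
      (s := (P.vars : Set (Idx N))) hc P.vars.finite_toSet
    intro r r' hrr
    simpa using hrr
  have := congrArg (fun D => D P) (commutator_pderiv_poisson a b i j r s)
  rw [Derivation.commutator_apply, h, pderiv_eq_zero_of_notMem_vars hr, map_zero, map_zero,
    sub_zero, Derivation.sub_apply] at this
  rw [ite_derivation_apply, ite_derivation_apply] at this
  exact (sub_eq_zero.1 this.symm)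

/-- The chain rule along the line from `X` to `X + δ`. -/
theorem exists_derivative_aeval_line {σ : Type*} (δ : σ → MvPolynomial σ ℂ)
    (P : MvPolynomial σ ℂ) : ∃ Ω₀ : Finset σ, ∀ Ω, Ω₀ ⊆ Ω →
      Polynomial.derivative
        (aeval (fun v => Polynomial.C (X v) + Polynomial.X * Polynomial.C (δ v)) P)
      = ∑ v ∈ Ω, aeval (fun v => Polynomial.C (X v) + Polynomial.X * Polynomial.C (δ v))
          (pderiv v P) * Polynomial.C (δ v) := by
  classical
  induction P using MvPolynomial.induction_on with
  | C c =>
    refine ⟨∅, fun Ω _ => ?_⟩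
    simp [Polynomial.algebraMap_apply]
  | add p q hp hq =>
    obtain ⟨Ω₁, h₁⟩ := hp
    obtain ⟨Ω₂, h₂⟩ := hq
    refine ⟨Ω₁ ∪ Ω₂, fun Ω hΩ => ?_⟩
    simp only [map_add, h₁ Ω (Finset.union_subset_left hΩ), h₂ Ω (Finset.union_subset_right hΩ),
      ← Finset.sum_add_distrib, add_mul]
  | mul_X p v hp =>
    obtain ⟨Ω₁, h₁⟩ := hp
    refine ⟨insert v Ω₁, fun Ω hΩ => ?_⟩
    have hv : v ∈ Ω := hΩ (Finset.mem_insert_self _ _)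
    rw [map_mul, Polynomial.derivative_mul, h₁ Ω ((Finset.subset_insert _ _).trans hΩ), aeval_X]
    simp only [pderiv_mul, map_add, map_mul, aeval_X, pderiv_X, add_mul, Finset.sum_add_distrib]
    congr 1
    · rw [Finset.sum_mul]
      exact Finset.sum_congr rfl fun w _ => by ring
    · rw [Finset.sum_eq_single v]
      · simp
      · intro w _ hw
        simp [hw.symm]
      · exact fun h => absurd hv h

variable (m n : ℕ)

/-- The trace of the upper left block of the matrix of the coordinates of degree `s` in `t`. -/
def trX (s : ℕ) : MvPolynomial (Idx (m + n)) ℂ :=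
  ∑ i : Fin m, X (Fin.castAdd n i, Fin.castAdd n i, s)

/-- The projection of the coordinates onto the span of the lower right block and the identity of
the upper left block. -/
def projX (v : Idx (m + n)) : MvPolynomial (Idx (m + n)) ℂ :=
  if m ≤ v.1 ∧ m ≤ v.2.1 then X v
  else if v.1 = v.2.1 then C (m : ℂ)⁻¹ * trX m n v.2.2 else 0

variable {m n}

/-- The polynomial is constant along the line from each point to its projection. The derivatives in
off-diagonal directions outside the lower right block vanish, and those in the diagonal directions
of the upper left block agree, while the displacements in these directions sum to zero. -/
theorem eq_aeval_projX {P : MvPolynomial (Idx (m + n)) ℂ}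
    (h : ∀ (i j : Fin m) r, poisson (Fin.castAdd n i) (Fin.castAdd n j) r P = 0) :
    P = aeval (projX m n) P := by
  classical
  have hoff : ∀ (a b : Fin (m + n)) s, ¬(m ≤ a ∧ m ≤ b) → a ≠ b → pderiv (a, b, s) P = 0 := by
    intro a b s hab hne
    induction a using Fin.addCases with
    | left a =>
      have := pderiv_eq_of_poisson_eq_zero (h a a) (Fin.castAdd n a) b s
      rwa [if_pos rfl, if_neg hne.symm] at this
    | right a =>
      induction b using Fin.addCases with
      | left b =>
        have := pderiv_eq_of_poisson_eq_zero (h b b) (Fin.natAdd m a) (Fin.castAdd n b) s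
        rw [if_pos rfl, if_neg hne] at this
        exact this.symm
      | right b => exact absurd ⟨by simp, by simp⟩ hab
  have hdiag : ∀ (i j : Fin m) s, pderiv (Fin.castAdd n i, Fin.castAdd n i, s) P
      = pderiv (Fin.castAdd n j, Fin.castAdd n j, s) P := by
    intro i j s
    have := pderiv_eq_of_poisson_eq_zero (h i j) (Fin.castAdd n i) (Fin.castAdd n j) s
    rw [if_pos rfl, if_pos rfl] at this
    exact this.symm
  let γ : Idx (m + n) → Polynomial (MvPolynomial (Idx (m + n)) ℂ) := fun v =>
    Polynomial.C (X v) + Polynomial.X * Polynomial.C (projX m n v - X v)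
  obtain ⟨Ω₀, hΩ⟩ := exists_derivative_aeval_line (fun v => projX m n v - X v) P
  let R := Ω₀.sup (fun v => v.2.2) + 1
  have hsub : Ω₀ ⊆ Finset.univ ×ˢ (Finset.univ ×ˢ Finset.range R) := by
    intro v hv
    simp only [Finset.mem_product, Finset.mem_univ, Finset.mem_range, true_and]
    exact Nat.lt_succ_of_le (Finset.le_sup (f := fun v : Idx (m + n) => v.2.2) hv)
  have hd : Polynomial.derivative (aeval γ P) = 0 := by
    have h1 := hΩ _ hsub
    change _ = ∑ v ∈ _, aeval γ (pderiv v P) * _ at h1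
    refine h1.trans ?_
    rw [Finset.sum_product]
    rw [Finset.sum_congr rfl fun a _ => Finset.sum_product _ _ _]
    have h2 : ∀ a b s, aeval γ (pderiv (a, b, s) P) * Polynomial.C (projX m n (a, b, s) - X (a, b, s))
        = if a = b ∧ a < m then aeval γ (pderiv (a, a, s) P)
          * Polynomial.C (projX m n (a, a, s) - X (a, a, s)) else 0 := by
      intro a b s
      by_cases hab : m ≤ a ∧ m ≤ b
      · rw [if_neg (by omega), projX, if_pos hab, sub_self, map_zero, mul_zero]
      · by_cases hne : a = b
        · subst hne
          rw [if_pos ⟨rfl, by omega⟩]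
        · rw [hoff a b s hab hne, map_zero, zero_mul, if_neg (by tauto)]
    rw [Finset.sum_congr rfl fun a _ => Finset.sum_congr rfl fun b _ =>
      Finset.sum_congr rfl fun s _ => h2 a b s]
    rw [Fin.sum_univ_add]
    have h3 : ∀ a : Fin n, ∑ b : Fin (m + n), ∑ s ∈ Finset.range R,
        (if Fin.natAdd m a = b ∧ (Fin.natAdd m a : ℕ) < m then
          aeval γ (pderiv (Fin.natAdd m a, Fin.natAdd m a, s) P)
          * Polynomial.C (projX m n (Fin.natAdd m a, Fin.natAdd m a, s)
            - X (Fin.natAdd m a, Fin.natAdd m a, s)) else 0) = 0 := by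
      intro a
      refine Finset.sum_eq_zero fun b _ => Finset.sum_eq_zero fun s _ => if_neg ?_
      simp
    rw [Finset.sum_eq_zero fun a _ => h3 a, add_zero]
    have h4 : ∀ a : Fin m, ∑ b : Fin (m + n), ∑ s ∈ Finset.range R,
        (if Fin.castAdd n a = b ∧ (Fin.castAdd n a : ℕ) < m then
          aeval γ (pderiv (Fin.castAdd n a, Fin.castAdd n a, s) P)
          * Polynomial.C (projX m n (Fin.castAdd n a, Fin.castAdd n a, s)
            - X (Fin.castAdd n a, Fin.castAdd n a, s)) else 0)
        = ∑ s ∈ Finset.range R, aeval γ (pderiv (Fin.castAdd n a, Fin.castAdd n a, s) P)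
          * Polynomial.C (C (m : ℂ)⁻¹ * trX m n s - X (Fin.castAdd n a, Fin.castAdd n a, s)) := by
      intro a
      rw [Finset.sum_comm]
      refine Finset.sum_congr rfl fun s _ => ?_
      rw [Finset.sum_eq_single (Fin.castAdd n a)]
      · rw [if_pos ⟨rfl, by simp⟩, projX, if_neg (by simp), if_pos rfl]
      · intro b _ hb
        exact if_neg fun h => hb h.1.symm
      · simp
    rw [Finset.sum_congr rfl fun a _ => h4 a, Finset.sum_comm]
    refine Finset.sum_eq_zero fun s _ => ?_
    rcases Nat.eq_zero_or_pos m with rfl | hm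
    · simp
    · rw [Finset.sum_congr rfl fun a _ => by rw [hdiag a ⟨0, hm⟩], ← Finset.mul_sum, ← map_sum,
        Finset.sum_sub_distrib]
      have : (m : ℂ) ≠ 0 := by exact_mod_cast hm.ne'
      have h5 : (m : MvPolynomial (Idx (m + n)) ℂ) * C (m : ℂ)⁻¹ = 1 := by
        rw [← map_natCast (C : ℂ →+* MvPolynomial (Idx (m + n)) ℂ), ← map_mul,
          mul_inv_cancel₀ this, map_one]
      rw [Finset.sum_const, Finset.card_univ, Fintype.card_fin, nsmul_eq_mul, ← mul_assoc, h5,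
        one_mul, trX, sub_self, map_zero, mul_zero]
  -- In characteristic zero a vanishing derivative makes the polynomial constant in the line
  -- parameter, so its values at `0` and `1` coincide; these are `P` and its projection.
  have hc := Polynomial.eq_C_of_natDegree_eq_zero
    (Polynomial.derivative_eq_zero.1 hd)
  have ev : ∀ c : MvPolynomial (Idx (m + n)) ℂ, Polynomial.eval c (aeval γ P)
      = aeval (fun v => X v + c * (projX m n v - X v)) P := by
    intro c
    have : ((Polynomial.aeval c).restrictScalars ℂ).comp (aeval γ)
        = aeval (fun v => X v + c * (projX m n v - X v)) := by
      ext v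
      simp [γ]
    rw [← this]
    simp [Polynomial.coe_aeval_eq_eval]
  have e0 := ev 0
  have e1 := ev 1
  rw [hc, Polynomial.eval_C] at e0 e1
  rw [e0] at e1
  simpa using e1

/-- The centralizer of `𝔤𝔩_m[t]` in the symmetric algebra of `𝔤𝔩_{m+n}[t]`. -/
theorem mem_adjoin_of_poisson_eq_zero {P : MvPolynomial (Idx (m + n)) ℂ}
    (h : ∀ (i j : Fin m) r, poisson (Fin.castAdd n i) (Fin.castAdd n j) r P = 0) :
    P ∈ Algebra.adjoin ℂ (Set.range (trX m n)
      ∪ Set.range fun v : Idx n => X (Fin.natAdd m v.1, Fin.natAdd m v.2.1, v.2.2)) := by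
  rw [eq_aeval_projX h]
  have : aeval (projX m n) P ∈ (aeval (R := ℂ) (projX m n)).range := ⟨P, rfl⟩
  rw [← Algebra.adjoin_range_eq_range_aeval] at this
  refine (Algebra.adjoin_le ?_) this
  rintro _ ⟨⟨a, b, s⟩, rfl⟩
  rw [projX]
  split_ifs with h1 h2
  · induction a using Fin.addCases with
    | left a => exact absurd h1.1 (by simp)
    | right a =>
      induction b using Fin.addCases with
      | left b => exact absurd h1.2 (by simp)
      | right b => exact Algebra.subset_adjoin (Or.inr ⟨(a, b, s), rfl⟩)
  · rw [← algebraMap_eq]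
    exact mul_mem (Subalgebra.algebraMap_mem _ _) (Algebra.subset_adjoin (Or.inl ⟨s, rfl⟩))
  · exact zero_mem _

end

/-! ### Relations between `T(u)` and `T(v)⁻¹`. -/

section Inverse

variable {n : ℕ} {B : Type*} [Ring B]

/-- Multiply the RTT relation by `D'` on both sides and sum over `h` and `k`. On the right, one
product of `D` with `D'` collapses to a Kronecker delta in each term. -/
theorem rtt_inv_aux {R : Type*} [Ring R] (α β : R) (hα : ∀ z, α * z = z * α)
    (hβ : ∀ z, β * z = z * β) (A D D' : Fin n → Fin n → R)
    (hAD : ∀ a b h k, α * (A a b * D h k - D h k * A a b) = β * (A h b * D a k - D h b * A a k))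
    (h1 : ∀ i j, ∑ l, D i l * D' l j = if i = j then 1 else 0)
    (h2 : ∀ i j, ∑ l, D' i l * D l j = if i = j then 1 else 0) (a b j l : Fin n) :
    α * (A a b * D' j l - D' j l * A a b)
      = β * ((if b = j then ∑ c, A a c * D' c l else 0)
        - (if a = l then ∑ c, D' j c * A c b else 0)) := by
  have e1 : ∑ h, ∑ k, D' j h * (A a b * D h k - D h k * A a b) * D' k l
      = D' j l * A a b - A a b * D' j l := by
    have f1 : ∑ h, ∑ k, D' j h * (A a b * D h k) * D' k l = D' j l * A a b := by
      simp only [mul_assoc, ← Finset.mul_sum, h1]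
      simp
    have f2 : ∑ h, ∑ k, D' j h * (D h k * A a b) * D' k l = A a b * D' j l := by
      rw [Finset.sum_comm]
      simp only [← mul_assoc, ← Finset.sum_mul, h2]
      simp
    simp only [mul_sub, sub_mul, Finset.sum_sub_distrib, f1, f2]
  have e2 : ∑ h, ∑ k, D' j h * (A h b * D a k - D h b * A a k) * D' k l
      = (if a = l then ∑ c, D' j c * A c b else 0) - (if b = j then ∑ c, A a c * D' c l else 0) := by
    have f1 : ∑ h, ∑ k, D' j h * (A h b * D a k) * D' k l
        = if a = l then ∑ c, D' j c * A c b else 0 := by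
      simp only [mul_assoc, ← Finset.mul_sum, h1]
      split_ifs <;> simp
    have f2 : ∑ h, ∑ k, D' j h * (D h b * A a k) * D' k l
        = if b = j then ∑ c, A a c * D' c l else 0 := by
      rw [Finset.sum_comm]
      simp only [← mul_assoc, ← Finset.sum_mul, h2]
      rcases eq_or_ne b j with rfl | h
      · simp
      · simp [h, h.symm]
    simp only [mul_sub, sub_mul, Finset.sum_sub_distrib, f1, f2]
  have pull : ∀ c : R, (∀ z, c * z = z * c) → ∀ x y z : R, x * (c * y) * z = c * (x * y * z) := by
    intro c hc x y z
    rw [← mul_assoc x c, ← hc x]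
    simp only [mul_assoc]
  have e3 : α * (∑ h, ∑ k, D' j h * (A a b * D h k - D h k * A a b) * D' k l)
      = β * (∑ h, ∑ k, D' j h * (A h b * D a k - D h b * A a k) * D' k l) := by
    simp only [Finset.mul_sum, ← pull α hα, ← pull β hβ, hAD]
  rw [e1, e2] at e3
  rw [← neg_inj, ← mul_neg, ← mul_neg, neg_sub, neg_sub, e3]

theorem serX_ite (p : Prop) [Decidable p] (f : ℕ → B) :
    serX (fun r => if p then f r else 0) = if p then serX f else 0 := by
  split_ifs
  · rfl
  · simp only [serX]
    rw [show (PowerSeries.mk fun _ => (0 : B)) = 0 by ext; simp, map_zero]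

/-- The commutation relations between `T(u)` and `T(v)⁻¹`. -/
theorem IsRTT.inverse_rel {t t' : Fin n → Fin n → ℕ → B} (ht : IsRTT t)
    (h1 : ∀ i j r, convMul t t' i j r = if r = 0 ∧ i = j then 1 else 0)
    (h2 : ∀ i j r, convMul t' t i j r = if r = 0 ∧ i = j then 1 else 0) (a b j l : Fin n) :
    (∀ r, t a b 0 * t' j l r - t' j l r * t a b 0 = 0) ∧
    (∀ s, t a b s * t' j l 0 - t' j l 0 * t a b s = 0) ∧
    ∀ s r, (t a b (s + 1) * t' j l r - t' j l r * t a b (s + 1))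
        - (t a b s * t' j l (r + 1) - t' j l (r + 1) * t a b s)
      = (if b = j then ∑ c, t a c s * t' c l r else 0)
        - (if a = l then ∑ c, t' j c r * t c b s else 0) := by
  have serY_one : ∀ i j : Fin n, serY (fun r => if r = 0 ∧ i = j then (1 : B) else 0)
      = if i = j then 1 else 0 := by
    intro i j
    ext r a
    by_cases hij : i = j
    · simp only [serY, hij, and_true, PowerSeries.coeff_mk, if_true, PowerSeries.coeff_one]
      split_ifs <;> simp
    · simp [serY, hij]
  have h1' : ∀ i j, ∑ l, serY (t i l) * serY (t' l j) = if i = j then 1 else 0 := by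
    intro i j
    rw [← serY_convMul, ← serY_one]
    exact congrArg serY (funext (h1 i j))
  have h2' : ∀ i j, ∑ l, serY (t' i l) * serY (t l j) = if i = j then 1 else 0 := by
    intro i j
    rw [← serY_convMul, ← serY_one]
    exact congrArg serY (funext (h2 i j))
  have := rtt_inv_aux _ _ X_sub_C_X_comm C_X_mul_X_comm (fun i j => serX (t i j))
    (fun i j => serY (t i j)) (fun i j => serY (t' i j)) ht.series h1' h2' a b j l
  have e1 : ∀ (p : Prop) [Decidable p] (e : ℕ → ℕ → B), (if p then biSeries e else 0)
      = biSeries fun a b => if p then e a b else 0 := by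
    intro p _ e
    ext b a
    split_ifs <;> simp [biSeries]
  simp only [serX_mul_serY, serY_mul_serX, biSeries_sub, biSeries_sum, e1] at this
  exact (biSeries_eq_iff _ _).1 this

/-- Setting `v = u` in `(u - v) e(u, v)` gives zero; the boundary conditions remove the two ends of
the telescoping sum. -/
theorem sum_antidiagonal_sub_eq_zero (e : ℕ → ℕ → B) (h0 : ∀ r, e 0 r = 0) (h0' : ∀ s, e s 0 = 0)
    (q : ℕ) : ∑ p ∈ Finset.HasAntidiagonal.antidiagonal q, (e (p.1 + 1) p.2 - e p.1 (p.2 + 1)) = 0 := by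
  have h1 := Finset.Nat.sum_antidiagonal_succ (n := q) (f := fun p => e p.1 p.2)
  have h2 := Finset.Nat.sum_antidiagonal_succ' (n := q) (f := fun p => e p.1 p.2)
  simp only [h0, h0', zero_add] at h1 h2
  rw [Finset.sum_sub_distrib, ← h1, ← h2, sub_self]

end Inverse

/-! ### The substitution of `u - c` for `u` in series in `u⁻¹`. -/

section Shift

variable {B : Type*} [AddCommGroup B]

/-- The coefficient of `u^{-r}` in `(u - c)^{-k}`. -/
def shiftCoeff (c : ℕ) : ℕ → ℕ → ℕ
  | 0, 0 => 1
  | 0, _ + 1 => 0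
  | _ + 1, 0 => 0
  | k + 1, r + 1 => shiftCoeff c k r + c * shiftCoeff c (k + 1) r

theorem shiftCoeff_of_lt (c : ℕ) {k r : ℕ} (h : r < k) : shiftCoeff c k r = 0 := by
  induction r generalizing k with
  | zero => obtain ⟨k, rfl⟩ := Nat.exists_eq_add_of_lt h; simp [shiftCoeff]
  | succ r ih =>
    obtain _ | k := k
    · omega
    · rw [shiftCoeff, ih (by omega), ih (by omega), mul_zero, add_zero]

theorem shiftCoeff_self (c k : ℕ) : shiftCoeff c k k = 1 := by
  induction k with
  | zero => rfl
  | succ k ih => rw [shiftCoeff, ih, shiftCoeff_of_lt c (Nat.lt_succ_self k), mul_zero, add_zero]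

theorem shiftCoeff_succ (c k : ℕ) : shiftCoeff c k (k + 1) = k * c := by
  induction k with
  | zero => simp [shiftCoeff]
  | succ k ih => rw [shiftCoeff, ih, shiftCoeff_self]; ring

/-- The coefficients of `f(u - c)`, where `f(u) = ∑ f_r u^{-r}`. -/
def shift (c : ℕ) (f : ℕ → B) (r : ℕ) : B := ∑ k ∈ Finset.range (r + 1), shiftCoeff c k r • f k

/-- Coefficients of `u f(u - c) = (u - c) f(u - c) + c f(u - c)`; the vanishing of `f 0` keeps the
first term free of positive powers. -/
theorem shift_succ (c : ℕ) {f : ℕ → B} (h0 : f 0 = 0) (r : ℕ) :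
    shift c f (r + 1) = shift c (fun k => f (k + 1)) r + c • shift c f r := by
  have h : shift c f r = ∑ k ∈ Finset.range (r + 1), shiftCoeff c (k + 1) r • f (k + 1) := by
    rw [shift, Finset.sum_range_succ', h0, smul_zero, add_zero, Finset.sum_range_succ,
      shiftCoeff_of_lt c (Nat.lt_succ_self r), zero_smul, add_zero]
  rw [h, shift, Finset.sum_range_succ', h0, smul_zero, add_zero, shift, Finset.smul_sum,
    ← Finset.sum_add_distrib]
  refine Finset.sum_congr rfl fun k _ => ?_
  rw [shiftCoeff, add_smul, mul_smul]

theorem shift_zero (c : ℕ) (f : ℕ → B) : shift c f 0 = f 0 := by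
  simp [shift, shiftCoeff]

theorem shift_sub (c : ℕ) (f g : ℕ → B) (r : ℕ) :
    shift c (fun k => f k - g k) r = shift c f r - shift c g r := by
  simp only [shift, smul_sub, Finset.sum_sub_distrib]

theorem shift_sum (c : ℕ) {ι : Type*} (s : Finset ι) (f : ι → ℕ → B) (r : ℕ) :
    shift c (fun k => ∑ i ∈ s, f i k) r = ∑ i ∈ s, shift c (f i) r := by
  simp only [shift, Finset.smul_sum]
  rw [Finset.sum_comm]

theorem shift_ite (c : ℕ) (p : Prop) [Decidable p] (f : ℕ → B) (r : ℕ) :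
    shift c (fun k => if p then f k else 0) r = if p then shift c f r else 0 := by
  split_ifs
  · rfl
  · simp [shift]

theorem shift_mul_left {B : Type*} [Ring B] (c : ℕ) (b : B) (f : ℕ → B) (r : ℕ) :
    shift c (fun k => b * f k) r = b * shift c f r := by
  simp only [shift, Finset.mul_sum, mul_smul_comm]

theorem shift_mul_right {B : Type*} [Ring B] (c : ℕ) (b : B) (f : ℕ → B) (r : ℕ) :
    shift c (fun k => f k * b) r = shift c f r * b := by
  simp only [shift, Finset.sum_mul, smul_mul_assoc]

end Shift

/-! ### Centrality of the trace of `T(u - n)⁻¹ T(u)`. -/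

section Central

variable {n : ℕ} {B : Type*} [Ring B]

/-- The commutation relations between `T(u)` and `T(v - c)⁻¹`. -/
theorem IsRTT.shift_inverse_rel {t t' : Fin n → Fin n → ℕ → B} (ht : IsRTT t)
    (h1 : ∀ i j r, convMul t t' i j r = if r = 0 ∧ i = j then 1 else 0)
    (h2 : ∀ i j r, convMul t' t i j r = if r = 0 ∧ i = j then 1 else 0) (c : ℕ) (a b j l : Fin n) :
    (∀ r, t a b 0 * shift c (t' j l) r - shift c (t' j l) r * t a b 0 = 0) ∧
    (∀ s, t a b s * shift c (t' j l) 0 - shift c (t' j l) 0 * t a b s = 0) ∧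
    ∀ s r, (t a b (s + 1) * shift c (t' j l) r - shift c (t' j l) r * t a b (s + 1))
        - (t a b s * shift c (t' j l) (r + 1) - shift c (t' j l) (r + 1) * t a b s)
        + c • (t a b s * shift c (t' j l) r - shift c (t' j l) r * t a b s)
      = (if b = j then ∑ d, t a d s * shift c (t' d l) r else 0)
        - (if a = l then ∑ d, shift c (t' j d) r * t d b s else 0) := by
  obtain ⟨e1, e2, e3⟩ := ht.inverse_rel h1 h2 a b j l
  have key : ∀ s r, t a b s * shift c (t' j l) r - shift c (t' j l) r * t a b s
      = shift c (fun k => t a b s * t' j l k - t' j l k * t a b s) r := by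
    intro s r
    rw [shift_sub, shift_mul_left, shift_mul_right]
  refine ⟨fun r => ?_, fun s => ?_, fun s r => ?_⟩
  · rw [key]
    simp only [e1]
    simp [shift]
  · rw [key, shift_zero, e2]
  · simp only [key]
    rw [shift_succ c (e2 s)]
    have h := congrArg (fun f => shift c f r) (funext (e3 s))
    simp only [shift_sub, shift_ite, shift_sum, shift_mul_left, shift_mul_right] at h
    simp only [shift_sub, shift_mul_left, shift_mul_right]
    rw [← h]
    abel

/-- The coefficients of the trace of `T(u - c)⁻¹ T(u)`. -/
def shiftTrace (t t' : Fin n → Fin n → ℕ → B) (c q : ℕ) : B :=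
  ∑ p ∈ Finset.HasAntidiagonal.antidiagonal q, ∑ j, ∑ d, shift c (t' j d) p.2 * t d j p.1

/-- Set `v = u` in the relation between `T(u)` and `T(v - n)⁻¹` and sum over `b = j`. The Kronecker
delta then contributes the factor `n`, which equals the shift, so the products in the order `T T⁻¹`
cancel and those in the order `T⁻¹ T` remain. -/
theorem IsRTT.contraction {t t' : Fin n → Fin n → ℕ → B} (ht : IsRTT t)
    (h1 : ∀ i j r, convMul t t' i j r = if r = 0 ∧ i = j then 1 else 0)
    (h2 : ∀ i j r, convMul t' t i j r = if r = 0 ∧ i = j then 1 else 0) (i l : Fin n) (q : ℕ) :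
    n • ∑ p ∈ Finset.HasAntidiagonal.antidiagonal q, ∑ j, shift n (t' j l) p.2 * t i j p.1
      = if i = l then shiftTrace t t' n q else 0 := by
  let e : ℕ → ℕ → B := fun s r =>
    ∑ j, (t i j s * shift n (t' j l) r - shift n (t' j l) r * t i j s)
  have hz := sum_antidiagonal_sub_eq_zero e
    (fun r => Finset.sum_eq_zero fun j _ => (ht.shift_inverse_rel h1 h2 n i j j l).1 r)
    (fun s => Finset.sum_eq_zero fun j _ => (ht.shift_inverse_rel h1 h2 n i j j l).2.1 s) q
  have hrel : ∀ s r, e (s + 1) r - e s (r + 1) + n • e s r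
      = n • (∑ d, t i d s * shift n (t' d l) r)
        - (if i = l then ∑ j, ∑ d, shift n (t' j d) r * t d j s else 0) := by
    intro s r
    simp only [e, Finset.smul_sum, ← Finset.sum_sub_distrib, ← Finset.sum_add_distrib]
    rw [Finset.sum_congr rfl fun j _ => (ht.shift_inverse_rel h1 h2 n i j j l).2.2 s r,
      Finset.sum_sub_distrib]
    congr 1
    · simp [Finset.smul_sum]
    · split_ifs <;> simp
  have hsum := Finset.sum_congr (s₁ := Finset.HasAntidiagonal.antidiagonal q) rfl
    fun p _ => hrel p.1 p.2
  rw [Finset.sum_add_distrib, hz, zero_add, Finset.sum_sub_distrib, ← Finset.smul_sum,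
    ← Finset.smul_sum] at hsum
  simp only [e, Finset.sum_sub_distrib, smul_sub] at hsum
  rw [sub_right_inj] at hsum
  rw [hsum, shiftTrace]
  split_ifs <;> simp

/-- For `A = T(u)`, `D = T(v)` and `B` a multiple of `T(u - n)⁻¹`, the scalars `α`, `ω` are `u - v`
and `v - u + n` times `β`. Moving `D` from the right of `B A` to its left, past `A` by `r1` and past
`B` by `r2`, turns `z D` into `D z`; the condition on `ω + α` makes the correction terms cancel. -/
theorem contraction_central_aux {S R : Type*} [CommRing S] [Ring R] [Algebra S R] (α β ω : S)
    (z : R) (A B D : Fin n → Fin n → R) (hω : ω + α = n • β)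
    (r1 : ∀ i h a b, α • (A i h * D a b - D a b * A i h) = β • (A a h * D i b - D a h * A i b))
    (r2 : ∀ a b j l, ω • (D a b * B j l - B j l * D a b)
      = β • ((if b = j then ∑ c, D a c * B c l else 0) - (if a = l then ∑ c, B j c * D c b else 0)))
    (hz : ∀ i l, ∑ j, B j l * A i j = if i = l then z else 0) (a b : Fin n) :
    α • ω • (z * D a b - D a b * z) = 0 := by
  have s1 : ∀ j l i h a b, α • (B j l * A i h * D a b) - β • (B j l * A a h * D i b)
      = α • (B j l * D a b * A i h) - β • (B j l * D a h * A i b) := by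
    intro j l i h a b
    have := congrArg (fun x => B j l * x) (r1 i h a b)
    simp only [mul_smul_comm, mul_sub, ← mul_assoc, smul_sub] at this
    rw [sub_eq_sub_iff_add_eq_add] at this ⊢
    rw [← sub_eq_zero] at this ⊢
    rw [← this]
    abel
  have s2 : ∀ j l i h a b,
      ω • (B j l * D a b * A i h) - β • (if a = l then ∑ c, B j c * D c b * A i h else 0)
      = ω • (D a b * B j l * A i h) - β • (if b = j then ∑ c, D a c * B c l * A i h else 0) := by
    intro j l i h a b
    have := congrArg (fun x => x * A i h) (r2 a b j l)
    simp only [smul_mul_assoc, sub_mul, smul_sub, ite_mul, zero_mul, Finset.sum_mul] at this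
    generalize β • (if b = j then ∑ c, D a c * B c l * A i h else 0) = X at this ⊢
    generalize β • (if a = l then ∑ c, B j c * D c b * A i h else 0) = Y at this ⊢
    rw [sub_eq_sub_iff_add_eq_add] at this ⊢
    rw [← sub_eq_zero] at this ⊢
    rw [← neg_inj, neg_zero, ← this]
    abel
  have hzD : ∀ i l c d, ∑ j, B j l * A i j * D c d = if i = l then z * D c d else 0 := by
    intro i l c d
    rw [← Finset.sum_mul, hz, ite_mul, zero_mul]
  have hDz : ∀ i l c d, ∑ j, D c d * B j l * A i j = if i = l then D c d * z else 0 := by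
    intro i l c d
    simp only [mul_assoc]
    rw [← Finset.mul_sum, hz, mul_ite, mul_zero]
  -- This combination becomes `B D A` by `r1`. The sum over `c` below completes it to the left sides
  -- of `s2`, so `D` can also pass `B`. The sum is evaluated before the moves in `hl` and after them
  -- in `hr`.
  let G : Fin n → Fin n → Fin n → Fin n → Fin n → R := fun j l i a h =>
    α • (B j l * A i h * D a b) - β • (B j l * A a h * D i b)
  have hl : ∑ j, (ω • G j a a a j - β • ∑ c, G j c a c j) = α • ω • (z * D a b) := by
    have g1 : ∀ l i a, ∑ j, G j l i a j
        = α • (if i = l then z * D a b else 0) - β • (if a = l then z * D i b else 0) := by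
      intro l i a
      simp only [G, Finset.sum_sub_distrib, ← Finset.smul_sum, hzD]
    rw [Finset.sum_sub_distrib, ← Finset.smul_sum, ← Finset.smul_sum, Finset.sum_comm]
    simp only [g1, Finset.sum_sub_distrib, ← Finset.smul_sum]
    simp only [if_true, Finset.sum_ite_eq, Finset.mem_univ, Finset.sum_const, Finset.card_univ,
      Fintype.card_fin]
    have hω' : ω = n • β - α := by rw [← hω]; ring
    rw [hω']
    simp only [← Nat.cast_smul_eq_nsmul S]
    module
  have hr : ∑ j, (ω • G j a a a j - β • ∑ c, G j c a c j) = α • ω • (D a b * z) := by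
    have g2 : ∀ j, ω • G j a a a j - β • ∑ c, G j c a c j
        = α • (ω • (D a b * B j a * A a j)
            - β • (if b = j then ∑ c, D a c * B c a * A a j else 0))
          - β • (ω • (D a j * B j a * A a b) - β • ∑ c, D a c * B c a * A a b) := by
      intro j
      have t1 := s2 j a a j a b
      have t2 := s2 j a a b a j
      simp only [if_true] at t1 t2
      rw [← t1, ← t2]
      simp only [G, s1, Finset.sum_sub_distrib, ← Finset.smul_sum]
      module
    rw [Finset.sum_congr rfl fun j _ => g2 j]
    simp only [Finset.sum_sub_distrib, ← Finset.smul_sum, hDz, Finset.sum_ite_eq, Finset.mem_univ,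
      if_true, Finset.sum_const, Finset.card_univ, Fintype.card_fin]
    have hω' : ω = n • β - α := by rw [← hω]; ring
    rw [hω']
    simp only [← Nat.cast_smul_eq_nsmul S]
    module
  rw [smul_sub, smul_sub, ← hl, ← hr, sub_self]
end Central

section Central

variable {n : ℕ} {B : Type*} [Ring B]

theorem eq_biSeries (f : PowerSeries (PowerSeries B)) :
    ∃ e, f = biSeries e :=
  ⟨fun a b => PowerSeries.coeff a (PowerSeries.coeff b f), by
    ext b a; rw [coeff_coeff_biSeries]⟩

/-- The equation determines the coefficients recursively in the first index, starting from zero. -/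
theorem eq_zero_of_X_sub_C_X_mul (f : PowerSeries (PowerSeries B))
    (h : (PowerSeries.X - PowerSeries.C PowerSeries.X) * f = 0) : f = 0 := by
  obtain ⟨e, rfl⟩ := eq_biSeries f
  have h0 : biSeries (fun _ _ => (0 : B)) = 0 := by ext; simp [biSeries]
  obtain ⟨h1, -, h3⟩ := (biSeries_eq_iff e fun _ _ => 0).1 (by rw [h, h0, mul_zero])
  rw [← h0]
  refine biSeries_inj.2 fun a => ?_
  induction a with
  | zero => exact h1
  | succ a ih => intro b; rw [sub_eq_zero.1 (h3 a b), ih]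

theorem eq_zero_of_shift_mul (c : ℕ) (f : PowerSeries (PowerSeries B))
    (h : (c • (PowerSeries.C PowerSeries.X * PowerSeries.X)
      - (PowerSeries.X - PowerSeries.C PowerSeries.X)) * f = 0) : f = 0 := by
  obtain ⟨e, rfl⟩ := eq_biSeries f
  have h0 : biSeries (fun _ _ => (0 : B)) = 0 := by ext; simp [biSeries]
  have hc : biSeries (fun a b => c • e a b) = c • biSeries e := by
    ext b a
    rw [coeff_coeff_biSeries, map_nsmul, map_nsmul, coeff_coeff_biSeries]
  obtain ⟨h1, -, h3⟩ := (biSeries_eq_iff e fun a b => c • e a b).1 (by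
    rw [sub_mul, smul_mul_assoc, sub_eq_zero] at h
    rw [← h, hc, mul_smul_comm])
  rw [← h0]
  refine biSeries_inj.2 fun a => ?_
  induction a with
  | zero => exact h1
  | succ a ih => intro b; rw [sub_eq_iff_eq_add.1 (h3 a b), ih, ih, smul_zero, add_zero]

/-- The coefficients of the trace of `T(u - n)⁻¹ T(u)` commute with the coefficients of `T(v)`. -/
theorem IsRTT.shiftTrace_comm {t t' : Fin n → Fin n → ℕ → B} (ht : IsRTT t)
    (h1 : ∀ i j r, convMul t t' i j r = if r = 0 ∧ i = j then 1 else 0)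
    (h2 : ∀ i j r, convMul t' t i j r = if r = 0 ∧ i = j then 1 else 0) (a b : Fin n) (q s : ℕ) :
    shiftTrace t t' n q * t a b s = t a b s * shiftTrace t t' n q := by
  let S := Subring.center (PowerSeries (PowerSeries B))
  let : Algebra S (PowerSeries (PowerSeries B)) :=
    RingHom.toAlgebra' S.subtype fun c x => (Subring.mem_center_iff.1 c.2 x).symm
  let α : S := ⟨PowerSeries.X - PowerSeries.C PowerSeries.X,
    Subring.mem_center_iff.2 fun z => (X_sub_C_X_comm z).symm⟩
  let β : S := ⟨PowerSeries.C PowerSeries.X * PowerSeries.X,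
    Subring.mem_center_iff.2 fun z => (C_X_mul_X_comm z).symm⟩
  have e1 : ∀ (p : Prop) [Decidable p] (e : ℕ → ℕ → B), (if p then biSeries e else 0)
      = biSeries fun a b => if p then e a b else 0 := by
    intro p _ e
    ext b a
    split_ifs <;> simp [biSeries]
  have hn : ∀ e : ℕ → ℕ → B, n • biSeries e = biSeries fun a b => n • e a b := by
    intro e
    ext b a
    rw [map_nsmul, map_nsmul, coeff_coeff_biSeries, coeff_coeff_biSeries]
  -- The factor `n` absorbs the one in `IsRTT.contraction`, so nothing has to be divided by `n` in
  -- `B`.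
  let U : Fin n → Fin n → ℕ → B := fun i j r => n • shift n (t' i j) r
  have hU0 : ∀ a b j l r, t a b 0 * U j l r - U j l r * t a b 0 = 0 := by
    intro a b j l r
    simp only [U, mul_smul_comm, smul_mul_assoc, ← smul_sub,
      (ht.shift_inverse_rel h1 h2 n a b j l).1 r, smul_zero]
  have hU0' : ∀ a b j l s, t a b s * U j l 0 - U j l 0 * t a b s = 0 := by
    intro a b j l s
    simp only [U, mul_smul_comm, smul_mul_assoc, ← smul_sub,
      (ht.shift_inverse_rel h1 h2 n a b j l).2.1 s, smul_zero]
  have hU : ∀ a b j l s r, (t a b (s + 1) * U j l r - U j l r * t a b (s + 1))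
      - (t a b s * U j l (r + 1) - U j l (r + 1) * t a b s)
      + n • (t a b s * U j l r - U j l r * t a b s)
      = (if b = j then ∑ d, t a d s * U d l r else 0)
        - (if a = l then ∑ d, U j d r * t d b s else 0) := by
    intro a b j l s r
    have := congrArg (fun x => n • x) ((ht.shift_inverse_rel h1 h2 n a b j l).2.2 s r)
    simp only [U, mul_smul_comm, smul_mul_assoc, ← smul_sub, ← smul_add, ← Finset.smul_sum]
    refine this.trans ?_
    split_ifs <;> simp [mul_sub]
  have key := contraction_central_aux α β (n • β - α) (serX (shiftTrace t t' n))
    (fun i j => serX (t i j)) (fun i j => serX (U i j))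
    (fun i j => serY (t i j)) (sub_add_cancel _ _)
    (fun i h a b => ht.series i h a b)
    (fun a b j l => by
      simp only [sub_smul, smul_assoc, serX_mul_serY, serY_mul_serX, biSeries_sub, biSeries_sum, e1]
      have h := (biSeries_eq_iff (fun r s => t a b s * U j l r - U j l r * t a b s)
        fun r s => n • (t a b s * U j l r - U j l r * t a b s)
          - ((if b = j then ∑ d, t a d s * U d l r else 0)
            - (if a = l then ∑ d, U j d r * t d b s else 0))).2
        ⟨fun s => hU0' a b j l s, fun r => hU0 a b j l r, fun r s => by
          rw [← hU a b j l s r]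
          abel⟩
      rw [← biSeries_sub (fun r s => n • (t a b s * U j l r - U j l r * t a b s)) fun r s =>
        (if b = j then ∑ d, t a d s * U d l r else 0) - (if a = l then ∑ d, U j d r * t d b s else 0),
        ← hn, mul_sub, mul_smul_comm] at h
      rw [sub_eq_iff_eq_add, ← sub_eq_iff_eq_add']
      exact h.symm)
    (fun i l => by
      have hc := ht.contraction h1 h2 i l
      have h : (fun r => ∑ p ∈ Finset.HasAntidiagonal.antidiagonal r, ∑ j, U j l p.1 * t i j p.2)
          = fun r => if i = l then shiftTrace t t' n r else 0 := by
        funext r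
        rw [← hc, ← Finset.Nat.sum_antidiagonal_swap]
        simp only [U, smul_mul_assoc, ← Finset.smul_sum, Prod.fst_swap, Prod.snd_swap]
      rw [← serX_ite, ← h]
      simp only [serX, ← map_mul, ← map_sum]
      congr 1
      ext r
      simp only [PowerSeries.coeff_mk, map_sum, PowerSeries.coeff_mul]
      rw [Finset.sum_comm]) a b
  -- Neither `α` nor `n β - α` is a zero divisor.
  have key2 := eq_zero_of_shift_mul n _ (eq_zero_of_X_sub_C_X_mul _ key)
  rw [serX_mul_serY, serY_mul_serX, sub_eq_zero] at key2
  exact biSeries_inj.1 key2 q s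

end Central

/-! ### Central elements of the Yangian with the traces as symbols. -/

section InverseSeries

variable {n : ℕ}

/-- The coefficients of the entries of `T(u)⁻¹`. -/
def Tinv (n : ℕ) (i j : Fin n) (r : ℕ) : Yangian n :=
  (-1 : ℂ) ^ r • PowerSeries.coeff r (TnegInv n) i j

theorem T_isRTT (n : ℕ) : IsRTT (T n) := ⟨T_zero n, T_rel n⟩

theorem coeff_Tneg (r : ℕ) (i j : Fin n) :
    PowerSeries.coeff r (Tneg n) i j = (-1 : ℂ) ^ r • T n i j r := by
  rw [Tneg, PowerSeries.coeff_mk, Matrix.of_apply, Algebra.smul_def, map_pow, map_neg, map_one]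

theorem convMul_T_Tinv (i j : Fin n) (r : ℕ) :
    convMul (T n) (Tinv n) i j r = if r = 0 ∧ i = j then 1 else 0 := by
  have h := congrArg (fun f : PowerSeries (Matrix (Fin n) (Fin n) (Yangian n)) =>
    PowerSeries.coeff r f i j) (Tneg_mul_TnegInv n)
  simp only [PowerSeries.coeff_mul, Matrix.sum_apply, Matrix.mul_apply, coeff_Tneg,
    PowerSeries.coeff_one] at h
  have h' : (if r = 0 ∧ i = j then (1 : Yangian n) else 0)
      = (-1 : ℂ) ^ r • (if r = 0 then (1 : Matrix (Fin n) (Fin n) (Yangian n)) else 0) i j := by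
    rcases eq_or_ne r 0 with rfl | hr
    · simp [Matrix.one_apply]
    · simp [hr]
  rw [h', ← h, convMul, Finset.smul_sum]
  refine Finset.sum_congr rfl fun p hp => ?_
  rw [Finset.HasAntidiagonal.mem_antidiagonal] at hp
  rw [Finset.smul_sum]
  refine Finset.sum_congr rfl fun l _ => ?_
  rw [Tinv, mul_smul_comm, smul_mul_assoc, smul_smul]
  congr 1
  rw [← hp, ← pow_add, show p.1 + p.2 + p.1 = 2 * p.1 + p.2 by ring, pow_add _ (2 * p.1), pow_mul]
  simp

theorem convMul_Tinv_T (i j : Fin n) (r : ℕ) :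
    convMul (Tinv n) (T n) i j r = if r = 0 ∧ i = j then 1 else 0 := by
  have h := congrArg (fun f : PowerSeries (Matrix (Fin n) (Fin n) (Yangian n)) =>
    PowerSeries.coeff r f i j) (TnegInv_mul_Tneg n)
  simp only [PowerSeries.coeff_mul, Matrix.sum_apply, Matrix.mul_apply, coeff_Tneg,
    PowerSeries.coeff_one] at h
  have h' : (if r = 0 ∧ i = j then (1 : Yangian n) else 0)
      = (-1 : ℂ) ^ r • (if r = 0 then (1 : Matrix (Fin n) (Fin n) (Yangian n)) else 0) i j := by
    rcases eq_or_ne r 0 with rfl | hr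
    · simp [Matrix.one_apply]
    · simp [hr]
  rw [h', ← h, convMul, Finset.smul_sum]
  refine Finset.sum_congr rfl fun p hp => ?_
  rw [Finset.HasAntidiagonal.mem_antidiagonal] at hp
  rw [Finset.smul_sum]
  refine Finset.sum_congr rfl fun l _ => ?_
  rw [Tinv, mul_smul_comm, smul_mul_assoc, smul_smul]
  congr 1
  rw [← hp, ← pow_add, show p.1 + p.2 + p.2 = 2 * p.2 + p.1 by ring, pow_add _ (2 * p.2), pow_mul]
  simp

theorem Tinv_zero (i j : Fin n) : Tinv n i j 0 = if i = j then 1 else 0 := by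
  have := convMul_T_Tinv i j 0
  simpa [convMul, T_zero] using this

/-- In `T(u) T(u)⁻¹ = 1` the two extreme terms of each coefficient have top degree, and the products
in between have one degree less. -/
theorem Tinv_add_T_mem (i j : Fin n) (r : ℕ) :
    Tinv n i j (r + 1) + T n i j (r + 1) ∈ Flt n (2 * r + 1) := by
  induction r using Nat.strong_induction_on generalizing i j with
  | _ r ih =>
    have h := convMul_T_Tinv i j (r + 1)
    rw [if_neg (by simp), convMul] at h
    have e1 : ∑ l, T n i l 0 * Tinv n l j (r + 1) = Tinv n i j (r + 1) := by simp [T_zero]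
    have e2 : ∑ l, T n i l (r + 1) * Tinv n l j 0 = T n i j (r + 1) := by simp [Tinv_zero]
    rcases r with _ | r
    · rw [Finset.Nat.sum_antidiagonal_succ] at h
      simp only [e1, Finset.Nat.antidiagonal_zero, Finset.sum_singleton, e2] at h
      rw [h]
      exact zero_mem _
    · rw [Finset.Nat.sum_antidiagonal_succ, Finset.Nat.sum_antidiagonal_succ'] at h
      simp only [e1, e2] at h
      have hm : ∑ p ∈ Finset.HasAntidiagonal.antidiagonal r,
          ∑ l, T n i l (p.1 + 1) * Tinv n l j (p.2 + 1) ∈ Flt n (2 * (r + 1) + 1) := by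
        refine sum_mem fun p hp => sum_mem fun l _ => ?_
        rw [Finset.HasAntidiagonal.mem_antidiagonal] at hp
        have hT := T_succ_mem_Flt i l p.1 (Nat.lt_succ_self _)
        have hT' : Tinv n l j (p.2 + 1) ∈ Flt n (2 * p.2 + 2) := by
          have := sub_mem (Flt_mono (Nat.le_succ _) (ih p.2 (by omega) l j))
            (T_succ_mem_Flt l j p.2 (Nat.lt_succ_self _))
          rwa [add_sub_cancel_right] at this
        exact mul_mem_Flt hT hT' (by omega)
      have h2 : Tinv n i j (r + 1 + 1) + T n i j (r + 1 + 1)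
          = -∑ p ∈ Finset.HasAntidiagonal.antidiagonal r,
            ∑ l, T n i l (p.1 + 1) * Tinv n l j (p.2 + 1) := by
        rw [eq_neg_iff_add_eq_zero, ← h]
        abel
      rw [h2]
      exact neg_mem hm

theorem Tinv_succ_mem_Flt (i j : Fin n) (r : ℕ) {d : ℕ} (h : 2 * r + 1 < d) :
    Tinv n i j (r + 1) ∈ Flt n d := by
  have := sub_mem (Flt_mono (by omega) (Tinv_add_T_mem i j r)) (T_succ_mem_Flt i j r h)
  rwa [add_sub_cancel_right] at this

/-- The first correction made by the shift is `(r + 1) c` times the preceding coefficient of the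
inverse, whose symbol is that of `-T`. -/
theorem shift_Tinv_sub_mem (c : ℕ) (i j : Fin n) (r : ℕ) :
    shift c (Tinv n i j) (r + 2) - Tinv n i j (r + 2) + ((r + 1) * c) • T n i j (r + 1)
      ∈ Flt n (2 * r + 1) := by
  have h1 : shift c (Tinv n i j) (r + 2) - Tinv n i j (r + 2) + ((r + 1) * c) • T n i j (r + 1)
      = ∑ k ∈ Finset.range r, shiftCoeff c (k + 1) (r + 2) • Tinv n i j (k + 1)
        + ((r + 1) * c) • (Tinv n i j (r + 1) + T n i j (r + 1)) := by
    rw [shift, Finset.sum_range_succ, shiftCoeff_self, one_smul, add_sub_cancel_right,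
      Finset.sum_range_succ, shiftCoeff_succ, Finset.sum_range_succ', smul_add, ← add_assoc]
    simp [shiftCoeff]
  rw [h1]
  refine add_mem (sum_mem fun k hk => ?_) (nsmul_mem (Tinv_add_T_mem i j r) _)
  rw [Finset.mem_range] at hk
  exact nsmul_mem (Tinv_succ_mem_Flt i j k (by omega)) _

theorem shift_Tinv_sub_mem' (c : ℕ) (i j : Fin n) (r : ℕ) :
    shift c (Tinv n i j) (r + 2) - Tinv n i j (r + 2) ∈ Flt n (2 * r + 2) := by
  have := sub_mem (Flt_mono (Nat.le_succ _) (shift_Tinv_sub_mem c i j r))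
    (nsmul_mem (T_succ_mem_Flt i j r (Nat.lt_succ_self _)) ((r + 1) * c))
  rwa [add_sub_cancel_right] at this

theorem shift_Tinv_zero (c : ℕ) (i j : Fin n) :
    shift c (Tinv n i j) 0 - Tinv n i j 0 = 0 := by
  rw [shift_zero, sub_self]

theorem shift_Tinv_one (c : ℕ) (i j : Fin n) :
    shift c (Tinv n i j) 1 - Tinv n i j 1 = 0 := by
  simp [shift, Finset.sum_range_succ, shiftCoeff]

/-- Without the shift the trace of `T⁻¹ T` has no coefficients of positive index, so only the
corrections due to the shift matter. Paired with `T^{(0)}`, they give the trace of `T^{(q+1)}` up to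
a scalar; paired with higher coefficients, they have lower degree. -/
theorem shiftTrace_add_mem (q : ℕ) :
    shiftTrace (T n) (Tinv n) n (q + 2) + ((q + 1) * n) • ∑ i, T n i i (q + 1)
      ∈ Flt n (2 * q + 1) := by
  let U : Fin n → Fin n → ℕ → Yangian n := fun i j r => shift n (Tinv n i j) r - Tinv n i j r
  have h1 : shiftTrace (T n) (Tinv n) n (q + 2)
      = ∑ p ∈ Finset.HasAntidiagonal.antidiagonal (q + 2), ∑ j, ∑ d, U j d p.2 * T n d j p.1 := by
    have h2 : ∑ p ∈ Finset.HasAntidiagonal.antidiagonal (q + 2),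
        ∑ j, ∑ d, Tinv n j d p.2 * T n d j p.1 = 0 := by
      rw [Finset.sum_comm]
      refine Finset.sum_eq_zero fun j _ => ?_
      have := convMul_Tinv_T j j (q + 2)
      rw [if_neg (by simp), convMul, ← Finset.Nat.sum_antidiagonal_swap] at this
      exact this
    rw [← sub_zero (shiftTrace _ _ _ _), ← h2, shiftTrace]
    simp only [← Finset.sum_sub_distrib, U, sub_mul]
  have h3 : ∑ j, ∑ d, U j d (q + 2) * T n d j 0 = ∑ j, U j j (q + 2) := by simp [T_zero]
  rw [h1, Finset.Nat.sum_antidiagonal_succ]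
  simp only [h3]
  rw [add_right_comm, Finset.smul_sum, ← Finset.sum_add_distrib]
  refine add_mem (sum_mem fun j _ => shift_Tinv_sub_mem n j j q) ?_
  refine sum_mem fun p hp => sum_mem fun j _ => sum_mem fun d _ => ?_
  rw [Finset.HasAntidiagonal.mem_antidiagonal] at hp
  obtain ⟨s, r⟩ := p
  simp only at hp ⊢
  rcases r with _ | _ | r
  · simp only [U, shift_Tinv_zero, zero_mul]; exact zero_mem _
  · simp only [U, zero_add, shift_Tinv_one, zero_mul]; exact zero_mem _
  · exact mul_mem_Flt (shift_Tinv_sub_mem' n j d r) (T_succ_mem_Flt d j s (Nat.lt_succ_self _))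
      (by omega)

theorem mem_center_of_comm {x : Yangian n} (h : ∀ v, x * gen v = gen v * x) :
    x ∈ Subalgebra.center ℂ (Yangian n) := by
  rw [Subalgebra.mem_center_iff]
  intro y
  have hy : y ∈ Algebra.adjoin ℂ (Set.range (gen (n := n))) := by rw [adjoin_gen]; trivial
  have hle : Algebra.adjoin ℂ (Set.range (gen (n := n))) ≤ Subalgebra.centralizer ℂ {x} := by
    refine Algebra.adjoin_le ?_
    rintro _ ⟨v, rfl⟩
    rw [SetLike.mem_coe, Subalgebra.mem_centralizer_iff]
    rintro _ rfl
    exact h v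
  exact ((Subalgebra.mem_centralizer_iff ℂ).1 (hle hy) x rfl).symm

theorem shiftTrace_mem_center (q : ℕ) :
    shiftTrace (T n) (Tinv n) n q ∈ Subalgebra.center ℂ (Yangian n) :=
  mem_center_of_comm fun v =>
    (T_isRTT n).shiftTrace_comm convMul_T_Tinv convMul_Tinv_T v.1 v.2.1 q (v.2.2 + 1)

open MvPolynomial in
/-- The center contains elements with the symbols `∑ X (i, i, q)`. -/
theorem exists_center_mem_Sym (n q : ℕ) : ∃ z ∈ Subalgebra.center ℂ (Yangian n),
    (z, ∑ i : Fin n, (X (i, i, q) : MvPolynomial (Idx n) ℂ)) ∈ Sym n (2 * q + 1) := by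
  -- The normalizing scalar `(q + 1) n` is invertible only for `n > 0`; for `n = 0` the trace is
  -- empty.
  rcases Nat.eq_zero_or_pos n with rfl | hn
  · exact ⟨0, zero_mem _, by
      rw [Finset.univ_eq_empty, Finset.sum_empty]
      exact Submodule.zero_mem (Sym 0 (2 * q + 1))⟩
  have hc : -(((q + 1) * n : ℕ) : ℂ) ≠ 0 := neg_ne_zero.2 (Nat.cast_ne_zero.2 (by positivity))
  refine ⟨(-(((q + 1) * n : ℕ) : ℂ))⁻¹ • shiftTrace (T n) (Tinv n) n (q + 2),
    Subalgebra.smul_mem _ (shiftTrace_mem_center _) _, ?_⟩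
  have h1 : (∑ i, T n i i (q + 1), ∑ i, (X (i, i, q) : MvPolynomial (Idx n) ℂ))
      ∈ Sym n (2 * q + 1) := by
    have : (∑ i, T n i i (q + 1), ∑ i, (X (i, i, q) : MvPolynomial (Idx n) ℂ))
        = ∑ i, (T n i i (q + 1), X (i, i, q)) := Prod.ext (by rw [Prod.fst_sum]) (by rw [Prod.snd_sum])
    rw [this]
    exact sum_mem fun i _ => gen_X_mem_Sym (i, i, q)
  have h2 := mem_Sym_of_mem_Flt (shiftTrace_add_mem (n := n) q)
  have h3 := add_mem h1 (Submodule.smul_mem _ (-(((q + 1) * n : ℕ) : ℂ))⁻¹ h2)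
  convert h3 using 1
  rw [Prod.smul_mk, Prod.mk_add_mk, smul_zero, add_zero, smul_add, ← Nat.cast_smul_eq_nsmul ℂ,
    smul_smul, inv_neg, neg_mul, inv_mul_cancel₀ (neg_ne_zero.1 hc), neg_one_smul]
  congr 1
  abel

end InverseSeries

/-! ### Symbols and commutation for `psi`. -/

section

open MvPolynomial

theorem commute_of_commute_gen {k l : ℕ} {A : Type*} [Ring A] [Algebra ℂ A]
    (f : Yangian k →ₐ[ℂ] A) (g : Yangian l →ₐ[ℂ] A)
    (h : ∀ v w, Commute (f (gen v)) (g (gen w))) (x : Yangian k) (y : Yangian l) :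
    Commute (f x) (g y) := by
  have h1 : ∀ v y, Commute (f (gen v)) (g y) := by
    intro v y
    have hle : Algebra.adjoin ℂ (Set.range (gen (n := l)))
        ≤ (Subalgebra.centralizer ℂ {f (gen v)}).comap g := by
      refine Algebra.adjoin_le ?_
      rintro _ ⟨w, rfl⟩
      rw [SetLike.mem_coe, Subalgebra.mem_comap, Subalgebra.mem_centralizer_iff]
      rintro _ rfl
      exact h v w
    rw [adjoin_gen] at hle
    exact (Subalgebra.mem_centralizer_iff ℂ).1 (hle (Algebra.mem_top (x := y))) _ rfl
  have hle : Algebra.adjoin ℂ (Set.range (gen (n := k)))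
      ≤ (Subalgebra.centralizer ℂ {g y}).comap f := by
    refine Algebra.adjoin_le ?_
    rintro _ ⟨w, rfl⟩
    rw [SetLike.mem_coe, Subalgebra.mem_comap, Subalgebra.mem_centralizer_iff]
    rintro _ rfl
    exact (h1 w y).symm
  rw [adjoin_gen] at hle
  exact ((Subalgebra.mem_centralizer_iff ℂ).1 (hle (Algebra.mem_top (x := x))) _ rfl).symm

theorem map_mem_Flt {k l : ℕ} (f : Yangian k →ₐ[ℂ] Yangian l)
    (h : ∀ v, f (gen v) ∈ Flt l (wt v + 1)) {d : ℕ} {x : Yangian k} (hx : x ∈ Flt k d) :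
    f x ∈ Flt l d := by
  have hw : ∀ w, f (word w) ∈ Flt l (wtl w + 1) := by
    intro w
    induction w with
    | nil => rw [word_nil, map_one]; exact one_mem_Flt one_pos
    | cons v w ih =>
      rw [word_cons, map_mul]
      exact mul_mem_Flt (h v) ih (by rw [wtl_cons]; omega)
  refine (Flt_induction ((Flt l d).comap f.toLinearMap) fun w hd => ?_) hx
  exact Flt_mono hd (hw w)

theorem embed_T {k l : ℕ} (f : Fin k ↪ Fin l) (i j : Fin k) (r : ℕ) :
    embed f (T k i j r) = T l (f i) (f j) r := lift_T _ _ _ _ _ _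

theorem embed_mem_Flt {k l : ℕ} (f : Fin k ↪ Fin l) {d : ℕ} {x : Yangian k} (hx : x ∈ Flt k d) :
    embed f x ∈ Flt l d := by
  refine map_mem_Flt _ (fun v => ?_) hx
  rw [gen, embed_T]
  exact T_succ_mem_Flt _ _ _ (Nat.lt_succ_self _)

theorem embed_mem_Sym {k l : ℕ} (f : Fin k ↪ Fin l) {d : ℕ} {x : Yangian k} {P}
    (hx : (x, P) ∈ Sym k d) :
    (embed f x, rename (fun v : Idx k => ((f v.1, f v.2.1, v.2.2) : Idx l)) P) ∈ Sym l d := by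
  have hw : ∀ w, (embed f (word w), rename (fun v : Idx k => ((f v.1, f v.2.1, v.2.2) : Idx l))
      (mon w)) ∈ Sym l (wtl w) := by
    intro w
    induction w with
    | nil =>
      rw [word_nil, mon_nil, map_one, map_one]
      exact one_mem_Sym
    | cons v w ih =>
      rw [word_cons, mon_cons, map_mul, map_mul, rename_X, gen, embed_T]
      exact mul_mem_Sym (gen_X_mem_Sym (f v.1, f v.2.1, v.2.2)) ih
  refine (Sym_induction ((Sym l d).comap ((embed f).toLinearMap.prodMap
    (rename fun v : Idx k => ((f v.1, f v.2.1, v.2.2) : Idx l)).toLinearMap)) ?_ ?_) hx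
  · rintro w rfl
    exact hw w
  · intro w hd
    rw [Submodule.mem_comap, LinearMap.prodMap_apply, map_zero]
    exact mem_Sym_of_mem_Flt (embed_mem_Flt f (word_mem_Flt hd))

theorem omega_T (n : ℕ) (i j : Fin n) (r : ℕ) :
    omega n (T n i j r) = (-1 : ℂ) ^ r • Tinv n i j r := by
  have h : omega n (T n i j r) = PowerSeries.coeff r (TnegInv n) i j := lift_T _ _ _ _ _ _
  rw [h, Tinv, smul_smul, ← mul_pow]
  simp

theorem omega_mem_Flt {n d : ℕ} {x : Yangian n} (hx : x ∈ Flt n d) : omega n x ∈ Flt n d := by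
  refine map_mem_Flt _ (fun v => ?_) hx
  rw [gen, omega_T]
  exact Submodule.smul_mem _ _ (Tinv_succ_mem_Flt _ _ _ (Nat.lt_succ_self _))

theorem omega_T_sub_mem (n : ℕ) (i j : Fin n) (r : ℕ) :
    omega n (T n i j (r + 1)) - (-1 : ℂ) ^ r • T n i j (r + 1) ∈ Flt n (2 * r + 1) := by
  have := Submodule.smul_mem _ ((-1 : ℂ) ^ (r + 1)) (Tinv_add_T_mem i j r)
  convert this using 1
  rw [omega_T, pow_succ]
  module

variable (m n : ℕ)

/-- On symbols `omega` multiplies the coordinate of `T^{(r+1)}` by `(-1)^r`, and `psi` applies it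
twice. -/
theorem psi_T_sub_mem (i j : Fin n) (r : ℕ) :
    psi m n (T n i j (r + 1)) - T (m + n) (Fin.natAdd m i) (Fin.natAdd m j) (r + 1)
      ∈ Flt (m + n) (2 * r + 1) := by
  have h1 := omega_mem_Flt (embed_mem_Flt (Fin.natAddEmb m) (omega_T_sub_mem n i j r))
  rw [map_sub, map_sub, map_smul, map_smul, embed_T] at h1
  have h2 := Submodule.smul_mem _ ((-1 : ℂ) ^ r)
    (omega_T_sub_mem (m + n) (Fin.natAdd m i) (Fin.natAdd m j) r)
  rw [smul_sub, smul_smul, ← mul_pow, neg_one_mul, neg_neg, one_pow, one_smul] at h2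
  have := add_mem h1 h2
  convert this using 1
  rw [Fin.natAddEmb_apply, Fin.natAddEmb_apply, sub_add_sub_cancel]
  rfl

theorem psi_gen_mem_Sym (v : Idx n) :
    (psi m n (gen v), X (Fin.natAdd m v.1, Fin.natAdd m v.2.1, v.2.2)) ∈ Sym (m + n) (wt v) := by
  have h1 := mem_Sym_of_mem_Flt (psi_T_sub_mem m n v.1 v.2.1 v.2.2)
  have h2 := add_mem h1 (gen_X_mem_Sym (Fin.natAdd m v.1, Fin.natAdd m v.2.1, v.2.2))
  rw [Prod.mk_add_mk, zero_add, gen, sub_add_cancel] at h2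
  exact h2

/-- The indices come from different blocks, so both Kronecker deltas in `IsRTT.inverse_rel` vanish.
The commutator then depends only on the sum of the upper indices and can be moved to the one with
`T^{(0)}`, which is zero. -/
theorem stdEmb_comm_psi (x : Yangian m) (y : Yangian n) :
    Commute (stdEmb m n x) (psi m n y) := by
  -- The inner `omega n` is absorbed into the element, so generators need only be followed through
  -- `phi` and the outer `omega`.
  refine commute_of_commute_gen (stdEmb m n) ((omega (m + n)).comp (phi m n)) (fun v w => ?_) x
    (omega n y)
  have e1 : stdEmb m n (gen v)
      = T (m + n) (Fin.castAdd n v.1) (Fin.castAdd n v.2.1) (v.2.2 + 1) := embed_T _ _ _ _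
  have e2 : (omega (m + n)).comp (phi m n) (gen w) = (-1 : ℂ) ^ (w.2.2 + 1)
      • Tinv (m + n) (Fin.natAdd m w.1) (Fin.natAdd m w.2.1) (w.2.2 + 1) := by
    rw [AlgHom.comp_apply, ← omega_T]
    exact congrArg _ (embed_T _ _ _ _)
  rw [e1, e2]
  refine Commute.smul_right ?_ _
  have hne : ∀ (a : Fin m) (b : Fin n), Fin.castAdd n a ≠ Fin.natAdd m b := by
    intro a b h
    have := congrArg Fin.val h
    simp only [Fin.val_castAdd, Fin.val_natAdd] at this
    omega
  obtain ⟨h0, -, h2⟩ := (T_isRTT (m + n)).inverse_rel convMul_T_Tinv convMul_Tinv_T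
    (Fin.castAdd n v.1) (Fin.castAdd n v.2.1) (Fin.natAdd m w.1) (Fin.natAdd m w.2.1)
  simp only [if_neg (hne _ _), sub_zero] at h2
  have h3 : ∀ s r, T (m + n) (Fin.castAdd n v.1) (Fin.castAdd n v.2.1) s
      * Tinv (m + n) (Fin.natAdd m w.1) (Fin.natAdd m w.2.1) r
      - Tinv (m + n) (Fin.natAdd m w.1) (Fin.natAdd m w.2.1) r
        * T (m + n) (Fin.castAdd n v.1) (Fin.castAdd n v.2.1) s = 0 := by
    intro s
    induction s with
    | zero => exact h0
    | succ s ih => intro r; rw [sub_eq_zero.1 (h2 s r), ih]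
  exact sub_eq_zero.1 (h3 _ _)

/-! ### The product subspace, its symbols and the induction on the degree. -/

/-- The product of the image of the center of `Y_m` and of the image of `ψ_m`. -/
def centerMulPsi : Submodule ℂ (Yangian (m + n)) :=
  Subalgebra.toSubmodule ((Subalgebra.center ℂ (Yangian m)).map (stdEmb m n))
    * Subalgebra.toSubmodule (psi m n).range

variable {m n}

theorem stdEmb_mem_centerMulPsi {z : Yangian m} (hz : z ∈ Subalgebra.center ℂ (Yangian m)) :
    stdEmb m n z ∈ centerMulPsi m n := by
  rw [← mul_one (stdEmb m n z)]
  exact Submodule.mul_mem_mul ⟨z, hz, rfl⟩ (one_mem (psi m n).range)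

theorem psi_mem_centerMulPsi (y : Yangian n) : psi m n y ∈ centerMulPsi m n := by
  rw [← one_mul (psi m n y)]
  exact Submodule.mul_mem_mul
    (one_mem ((Subalgebra.center ℂ (Yangian m)).map (stdEmb m n))) ⟨y, rfl⟩

/-- The two factors commute, so their product is again a subalgebra. This is needed to lift products
of symbols. -/
theorem mul_mem_centerMulPsi {x y : Yangian (m + n)} (hx : x ∈ centerMulPsi m n)
    (hy : y ∈ centerMulPsi m n) : x * y ∈ centerMulPsi m n := by
  have h : centerMulPsi m n * centerMulPsi m n ≤ centerMulPsi m n := by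
    unfold centerMulPsi
    set Z := (Subalgebra.center ℂ (Yangian m)).map (stdEmb m n)
    set N := (psi m n).range
    have hcomm : Subalgebra.toSubmodule N * Subalgebra.toSubmodule Z
        ≤ Subalgebra.toSubmodule Z * Subalgebra.toSubmodule N := by
      rw [Submodule.mul_le]
      rintro _ ⟨y, rfl⟩ _ ⟨z, hz, rfl⟩
      have := (stdEmb_comm_psi m n z y).eq
      change psi m n y * stdEmb m n z ∈ _
      rw [← this]
      exact Submodule.mul_mem_mul ⟨z, hz, rfl⟩ ⟨y, rfl⟩
    calc Subalgebra.toSubmodule Z * Subalgebra.toSubmodule N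
          * (Subalgebra.toSubmodule Z * Subalgebra.toSubmodule N)
        = Subalgebra.toSubmodule Z * (Subalgebra.toSubmodule N * Subalgebra.toSubmodule Z)
          * Subalgebra.toSubmodule N := by simp only [mul_assoc]
      _ ≤ Subalgebra.toSubmodule Z * (Subalgebra.toSubmodule Z * Subalgebra.toSubmodule N)
          * Subalgebra.toSubmodule N :=
        mul_le_mul' (mul_le_mul' le_rfl hcomm) le_rfl
      _ = (Subalgebra.toSubmodule Z * Subalgebra.toSubmodule Z)
          * (Subalgebra.toSubmodule N * Subalgebra.toSubmodule N) := by simp only [mul_assoc]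
      _ = Subalgebra.toSubmodule Z * Subalgebra.toSubmodule N := by
        rw [Z.isIdempotentElem_toSubmodule.eq, N.isIdempotentElem_toSubmodule.eq]
  exact h (Submodule.mul_mem_mul hx hy)

theorem centerMulPsi_le : centerMulPsi m n ≤ Subalgebra.toSubmodule
    (Subalgebra.centralizer ℂ ((stdEmb m n).range : Set (Yangian (m + n)))) := by
  rw [centerMulPsi, Submodule.mul_le]
  rintro _ ⟨z, hz, rfl⟩ _ ⟨y, rfl⟩
  rw [Subalgebra.mem_toSubmodule]
  refine mul_mem ?_ ?_
  · rw [Subalgebra.mem_centralizer_iff]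
    rintro _ ⟨x, rfl⟩
    change stdEmb m n x * stdEmb m n z = stdEmb m n z * stdEmb m n x
    rw [← map_mul, ← map_mul, Subalgebra.mem_center_iff.1 hz]
  · rw [Subalgebra.mem_centralizer_iff]
    rintro _ ⟨x, rfl⟩
    exact (stdEmb_comm_psi m n x y).eq

/-- The symbols of the elements of `centerMulPsi m n`. -/
def symbols (m n : ℕ) : Submonoid (MvPolynomial (Idx (m + n)) ℂ) where
  carrier := {P | ∃ d, ∃ y ∈ centerMulPsi m n, (y, P) ∈ Sym (m + n) d}
  one_mem' := ⟨0, 1, by simpa using psi_mem_centerMulPsi (m := m) (1 : Yangian n), one_mem_Sym⟩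
  mul_mem' := by
    rintro P Q ⟨d, y, hy, hP⟩ ⟨e, z, hz, hQ⟩
    exact ⟨d + e, y * z, mul_mem_centerMulPsi hy hz, mul_mem_Sym hP hQ⟩

/-- Symbols are homogeneous while a sum of them need not be, so lifting is done one component at a
time. -/
theorem exists_mem_Sym_component {P : MvPolynomial (Idx (m + n)) ℂ}
    (hP : P ∈ Submodule.span ℂ (symbols m n : Set (MvPolynomial (Idx (m + n)) ℂ))) (d : ℕ) :
    ∃ y ∈ centerMulPsi m n, (y, weightedHomogeneousComponent wt d P) ∈ Sym (m + n) d := by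
  induction hP using Submodule.span_induction with
  | mem P hP =>
    obtain ⟨e, y, hy, h⟩ := hP
    have hh := isWeightedHomogeneous_of_mem_Sym h
    rw [weightedHomogeneousComponent_of_mem hh]
    split_ifs with hde
    · subst hde
      exact ⟨y, hy, h⟩
    · exact ⟨0, zero_mem _, zero_mem _⟩
  | zero =>
    rw [map_zero]
    exact ⟨0, zero_mem _, zero_mem _⟩
  | add P Q _ _ hP hQ =>
    obtain ⟨y, hy, h⟩ := hP
    obtain ⟨z, hz, h'⟩ := hQ
    rw [map_add]
    exact ⟨y + z, add_mem hy hz, add_mem h h'⟩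
  | smul c P _ hP =>
    obtain ⟨y, hy, h⟩ := hP
    rw [map_smul]
    exact ⟨c • y, Submodule.smul_mem _ _ hy, Submodule.smul_mem _ c h⟩

theorem exists_mem_Sym_of_mem_adjoin {P : MvPolynomial (Idx (m + n)) ℂ}
    (hP : P ∈ Algebra.adjoin ℂ (Set.range (trX m n)
      ∪ Set.range fun v : Idx n => X (Fin.natAdd m v.1, Fin.natAdd m v.2.1, v.2.2))) {d : ℕ}
    (hd : IsWeightedHomogeneous wt P d) :
    ∃ y ∈ centerMulPsi m n, (y, P) ∈ Sym (m + n) d := by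
  rw [← Subalgebra.mem_toSubmodule, Algebra.adjoin_eq_span] at hP
  have hle : Submonoid.closure (Set.range (trX m n)
      ∪ Set.range fun v : Idx n => X (Fin.natAdd m v.1, Fin.natAdd m v.2.1, v.2.2))
      ≤ symbols m n := by
    rw [Submonoid.closure_le]
    rintro _ (⟨s, rfl⟩ | ⟨v, rfl⟩)
    · obtain ⟨z, hz, h⟩ := exists_center_mem_Sym m s
      refine ⟨2 * s + 1, stdEmb m n z, stdEmb_mem_centerMulPsi hz, ?_⟩
      have h2 := embed_mem_Sym (Fin.castAddEmb n) h
      rw [map_sum] at h2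
      simp only [rename_X, Fin.castAddEmb_apply] at h2
      exact h2
    · exact ⟨wt v, psi m n (gen v), psi_mem_centerMulPsi _, psi_gen_mem_Sym m n v⟩
  obtain ⟨y, hy, h⟩ := exists_mem_Sym_component (Submodule.span_mono hle hP) d
  rw [weightedHomogeneousComponent_of_mem hd, if_pos rfl] at h
  exact ⟨y, hy, h⟩

/-- Induction on the degree: the symbol of a centralizing element is also the symbol of an element
of the product, and their difference centralizes in lower degree. -/
theorem centralizer_le_centerMulPsi : Subalgebra.toSubmodule
    (Subalgebra.centralizer ℂ ((stdEmb m n).range : Set (Yangian (m + n))))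
      ≤ centerMulPsi m n := by
  suffices h : ∀ d, ∀ x ∈ Flt (m + n) d, x ∈ Subalgebra.centralizer ℂ
      ((stdEmb m n).range : Set (Yangian (m + n))) → x ∈ centerMulPsi m n by
    intro x hx
    obtain ⟨d, hd⟩ := exists_mem_Flt x
    exact h d x hd hx
  intro d
  induction d with
  | zero =>
    intro x hx _
    rw [Flt_zero, Submodule.mem_bot] at hx
    rw [hx]
    exact zero_mem _
  | succ d ih =>
    intro x hx hc
    obtain ⟨P, hP⟩ := exists_mem_Sym hx
    have hpoisson : ∀ (i j : Fin m) r, poisson (Fin.castAdd n i) (Fin.castAdd n j) r P = 0 := by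
      intro i j r
      have h1 := comm_mem_Sym (Fin.castAdd n i) (Fin.castAdd n j) r hP
      have h2 := (Subalgebra.mem_centralizer_iff ℂ).1 hc
        (gen (Fin.castAdd n i, Fin.castAdd n j, r)) ⟨gen (i, j, r), embed_T _ _ _ _⟩
      rw [h2, sub_self] at h1
      -- The zero commutator has the Poisson bracket as a symbol, so PBW forces this bracket to
      -- vanish.
      exact eq_zero_of_zero_mem_Sym h1
    obtain ⟨y, hy, hyP⟩ := exists_mem_Sym_of_mem_adjoin (mem_adjoin_of_poisson_eq_zero hpoisson)
      (isWeightedHomogeneous_of_mem_Sym hP)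
    have h3 := sub_mem hP hyP
    rw [Prod.mk_sub_mk, sub_self] at h3
    have h4 := ih _ (mem_Flt_of_mem_Sym_zero h3) (sub_mem hc (centerMulPsi_le hy))
    have := add_mem h4 hy
    rwa [sub_add_cancel] at this

end

end Yangian

end

theorem theorem7p3 (m n : ℕ) :
    Subalgebra.toSubmodule
        (Subalgebra.centralizer ℂ ((Yangian.stdEmb m n).range : Set (Yangian (m + n))))
      = Subalgebra.toSubmodule
          ((Subalgebra.center ℂ (Yangian m)).map (Yangian.stdEmb m n))
        * Subalgebra.toSubmodule (Yangian.psi m n).range :=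
  le_antisymm Yangian.centralizer_le_centerMulPsi Yangian.centerMulPsi_le
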